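/- Let $F$ be a field of characteristic $2$. **Colength functions.** Let $I=[0,1]\cap\mathbb Z[\tfrac12]$ and let $X$ be the $\mathbb Q$-vector space of functions $I\to\mathbb Q$. For a nonzero element $f$ of the maximal ideal of $F[[u_1,\dots,u_r]]$, let $\phi_f\in X$ be the (well-defined) function $$\phi_f\!\left(\tfrac iq\right)=q^{-r}\dim_F F[[u_1,\dots,u_r]]/(u_1^q,\dots,u_r^q,f^i)\qquad(q \text{ a power of } 2,\ 0\le i\le q).$$ **The product $\#$.** For $\alpha\in X$ put $\alpha_0(t)=\alpha(\tfrac t2)$ and $\alpha_1(t)=\alpha(\tfrac{1+t}2)$. For $\alpha,\beta\in X$ the element $\alpha\#\beta$ of $X$ is defined by induction on the denominator of $t\in I$ by: 1. $(\alpha\#\beta)(0)=0$ and $(\alpha\#\beta)(1)=(\alpha(1)-\alpha(0))(\beta(1)-\beta(0))$; 2. $(\alpha\#\beta)(t)=(\alpha_0\#\beta_0)(2t)+(\alpha_1\#\beta_1)(2t)$ for $0\le t\le\tfrac12$; 3. $(\alpha\#\beta)(t)=(\alpha_0\#\beta_0)(1)+(\alpha_1\#\beta_1)(1)+(\alpha_0\#\beta_1)(2t-1)+(\alpha_1\#\beta_0)(2t-1)$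 for $\tfrac12\le t\le1$. **The ring $\Gamma$.** Let $\Gamma$ be the Grothendieck group (with respect to direct sums) of isomorphism classes of finitely generated $F[T]$-modules annihilated by a power of $T$, with the multiplication $[V][W]=[V\otimes_F W]$, where $T$ acts on $V\otimes_F W$ by $T_V\otimes\mathrm{id}+\mathrm{id}\otimes T_W$; let $\Gamma_{\mathbb Q}=\Gamma\otimes_{\mathbb Z}\mathbb Q$. For $i\ge0$ let $\lambda_i=(-1)^i\bigl([F[T]/T^{i+1}]-[F[T]/T^i]\bigr)\in\Gamma$. For $\alpha\in X$, $n\ge0$ and $q=2^n$ let $$\mathcal L_n(\alpha)=\sum_{i=0}^{q-1}\Bigl(\alpha\bigl(\tfrac{i+1}q\bigr)-\alpha\bigl(\tfrac iq\bigr)\Bigr)(-1)^i\lambda_i\in\Gamma_{\mathbb Q}.$$ **Theorem 1.9.** Let $f\ne0$ and $g\ne0$ be in the maximal ideals of $F[[u_1,\dots,u_r]]$ and $F[[v_1,\dots,v_s]]$, and let $h=f(u_1,\dots,u_r)+g(v_1,\dots,v_s)\in F[[u_1,\dots,u_r,v_1,\dots,v_s]]$. Then: 1. for every $n\ge0$,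 $\mathcal L_n(\phi_h)=\mathcal L_n(\phi_f)\cdot\mathcal L_n(\phi_g)$ in $\Gamma_{\mathbb Q}$; 2. $\phi_h=\phi_f\#\phi_g$. -/

import Mathlib

open scoped TensorProduct

noncomputable section

/-! ### Functions on the dyadic rationals of the unit interval -/

/-- `I = [0,1] ∩ ℤ[1/2]`. -/
def DyadicI : Type := {t : ℚ // 0 ≤ t ∧ t ≤ 1 ∧ ∃ (n : ℕ) (k : ℤ), t = k / 2 ^ n}

namespace DyadicI

/-- The point `i / 2 ^ n` of `I`. -/
def node (n i : ℕ) (hi : i ≤ 2 ^ n) : DyadicI :=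
  ⟨(i : ℚ) / 2 ^ n, by positivity,
    (div_le_one (by positivity)).2 (by exact_mod_cast hi), n, i, by simp⟩

/-- The point `0` of `I`. -/
def zero : DyadicI := ⟨0, le_rfl, zero_le_one, 0, 0, by simp⟩

/-- The point `1` of `I`. -/
def one : DyadicI := ⟨1, zero_le_one, le_rfl, 0, 1, by simp⟩

/-- `t ↦ t / 2`. -/
def half (t : DyadicI) : DyadicI :=
  ⟨t.1 / 2, by linarith [t.2.1], by linarith [t.2.2.1], by
    obtain ⟨n, k, h⟩ := t.2.2.2
    exact ⟨n + 1, k, by rw [h]; field_simp; ring⟩⟩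

/-- `t ↦ (1 + t) / 2`. -/
def halfSucc (t : DyadicI) : DyadicI :=
  ⟨(1 + t.1) / 2, by linarith [t.2.1], by linarith [t.2.2.1], by
    obtain ⟨n, k, h⟩ := t.2.2.2
    exact ⟨n + 1, 2 ^ n + k, by rw [h]; push_cast; field_simp; ring⟩⟩

/-- `t ↦ 2 t`, for `t ≤ 1 / 2`. -/
def double (t : DyadicI) (ht : t.1 ≤ 1 / 2) : DyadicI :=
  ⟨2 * t.1, by linarith [t.2.1], by linarith, by
    obtain ⟨n, k, h⟩ := t.2.2.2
    exact ⟨n, 2 * k, by rw [h]; push_cast; ring⟩⟩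

/-- `t ↦ 2 t - 1`, for `1 / 2 ≤ t`. -/
def doublePred (t : DyadicI) (ht : 1 / 2 ≤ t.1) : DyadicI :=
  ⟨2 * t.1 - 1, by linarith, by linarith [t.2.2.1], by
    obtain ⟨n, k, h⟩ := t.2.2.2
    exact ⟨n, 2 * k - 2 ^ n, by rw [h]; push_cast; field_simp⟩⟩

theorem den_eq_two_pow (t : DyadicI) (h0 : t.1 ≠ 0) (h1 : t.1 ≠ 1) :
    ∃ m : ℕ, t.1.den = 2 ^ (m + 1) := by
  obtain ⟨q, hq0, hq1, n, k, h⟩ := t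
  simp only at h0 h1 ⊢
  have hd : q.den ∣ 2 ^ n := by
    have := Rat.den_dvd k (2 ^ n)
    rw [Rat.divInt_eq_div] at this
    push_cast at this
    rw [← h] at this
    exact_mod_cast this
  obtain ⟨m, -, hm⟩ := (Nat.dvd_prime_pow Nat.prime_two).1 hd
  cases m with
  | succ m => exact ⟨m, hm⟩
  | zero =>
    exfalso
    have hn : (q.num : ℚ) = q := Rat.coe_int_num_of_den_eq_one (by simpa using hm)
    rw [← hn] at hq0 hq1 h0 h1
    have a0 : (0 : ℤ) ≤ q.num := by exact_mod_cast hq0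
    have a1 : q.num ≤ 1 := by exact_mod_cast hq1
    have a2 : q.num ≠ 0 := by exact_mod_cast h0
    have a3 : q.num ≠ 1 := by exact_mod_cast h1
    omega

theorem one_den_lt (t : DyadicI) (h0 : t.1 ≠ 0) (h1 : t.1 ≠ 1) : one.1.den < t.1.den := by
  obtain ⟨m, hm⟩ := t.den_eq_two_pow h0 h1
  rw [hm]
  exact Nat.one_lt_two_pow (Nat.succ_ne_zero m)

theorem den_lt_aux (t : DyadicI) (h0 : t.1 ≠ 0) (h1 : t.1 ≠ 1) (c : ℤ) :
    (2 * t.1 - c).den < t.1.den := by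
  obtain ⟨m, hm⟩ := t.den_eq_two_pow h0 h1
  have e : (2 * t.1 - c : ℚ) = Rat.divInt (t.1.num - c * 2 ^ m) (2 ^ m) := by
    rw [Rat.divInt_eq_div]
    push_cast
    have := Rat.num_div_den t.1
    rw [hm] at this
    push_cast at this
    conv_lhs => rw [← this]
    field_simp
    ring
  have hd : (2 * t.1 - c).den ∣ 2 ^ m := by
    rw [e]
    exact_mod_cast Rat.den_dvd (t.1.num - c * 2 ^ m) (2 ^ m)
  calc (2 * t.1 - c).den ≤ 2 ^ m := Nat.le_of_dvd (by positivity) hd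
    _ < t.1.den := by rw [hm]; exact Nat.pow_lt_pow_right (by norm_num) (Nat.lt_succ_self m)

theorem double_den_lt (t : DyadicI) (h0 : t.1 ≠ 0) (h1 : t.1 ≠ 1) (ht : t.1 ≤ 1 / 2) :
    (t.double ht).1.den < t.1.den := by
  simpa [double] using t.den_lt_aux h0 h1 0

theorem doublePred_den_lt (t : DyadicI) (h0 : t.1 ≠ 0) (h1 : t.1 ≠ 1) (ht : 1 / 2 ≤ t.1) :
    (t.doublePred ht).1.den < t.1.den := by
  simpa [doublePred] using t.den_lt_aux h0 h1 1

end DyadicI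

/-- The `ℚ`-vector space `X` of all functions `I → ℚ`. -/
abbrev DyadicFun : Type := DyadicI → ℚ

namespace DyadicFun

/-- `α₀ : t ↦ α (t / 2)`. -/
def T0 (α : DyadicFun) : DyadicFun := fun t => α t.half

/-- `α₁ : t ↦ α ((1 + t) / 2)`. -/
def T1 (α : DyadicFun) : DyadicFun := fun t => α t.halfSucc

/-- The product `α # β`, by recursion on the denominator of the argument. -/
def sharp (α β : DyadicFun) (t : DyadicI) : ℚ :=
  if _h0 : t.1 = 0 then 0
  else if _h1 : t.1 = 1 then
    (α DyadicI.one - α DyadicI.zero) * (β DyadicI.one - β DyadicI.zero)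
  else if h : t.1 ≤ 1 / 2 then
    sharp (T0 α) (T0 β) (t.double h) + sharp (T1 α) (T1 β) (t.double h)
  else
    sharp (T0 α) (T0 β) DyadicI.one + sharp (T1 α) (T1 β) DyadicI.one
      + sharp (T0 α) (T1 β) (t.doublePred (le_of_not_ge h))
      + sharp (T1 α) (T0 β) (t.doublePred (le_of_not_ge h))
termination_by t.1.den
decreasing_by
  all_goals
    first
    | exact t.double_den_lt _h0 _h1 h
    | exact t.doublePred_den_lt _h0 _h1 (le_of_not_ge h)
    | exact t.one_den_lt _h0 _h1

end DyadicFun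

/-! ### The colength function of a power series -/

/-- The colength of `(u₁ ^ q, …, u_r ^ q, f ^ i)` in `F[[u₁, …, u_r]]`, as an `F`-dimension. -/
def frobColength {F σ : Type*} [Field F] (f : MvPowerSeries σ F) (q i : ℕ) : ℕ :=
  Module.finrank F (MvPowerSeries σ F ⧸
    Ideal.span (Set.range (fun j : σ => (MvPowerSeries.X j : MvPowerSeries σ F) ^ q) ∪ {f ^ i}))

/-- `φ_f (i / q) = q ^ (-r) * deg (u₁ ^ q, …, u_r ^ q, f ^ i)`, the fraction `i / q` being taken
in lowest terms. -/
def phi {F σ : Type*} [Field F] [Fintype σ] (f : MvPowerSeries σ F) : DyadicFun :=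
  fun t => (frobColength f t.1.den t.1.num.toNat : ℚ) / (t.1.den : ℚ) ^ Fintype.card σ

/-! ### The representation ring `Γ` -/

universe u

/-- A finitely generated `F[T]`-module annihilated by a power of `T`, i.e. a finite dimensional
`F`-vector space with a nilpotent endomorphism `T`. -/
structure NilMod (F : Type u) [Field F] : Type (u + 1) where
  carrier : Type u
  [addCommGroup : AddCommGroup carrier]
  [module : Module F carrier]
  [finite : Module.Finite F carrier]
  T : carrier →ₗ[F] carrier
  nilpotent : IsNilpotent T

namespace NilMod

attribute [instance] addCommGroup module finite

variable {F : Type u} [Field F]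

/-- Isomorphism of `F[T]`-modules. -/
def Iso (V W : NilMod F) : Prop :=
  ∃ e : V.carrier ≃ₗ[F] W.carrier, e.toLinearMap ∘ₗ V.T = W.T ∘ₗ e.toLinearMap

theorem Iso.refl (V : NilMod F) : Iso V V := ⟨LinearEquiv.refl F _, rfl⟩

theorem Iso.symm {V W : NilMod F} (h : Iso V W) : Iso W V := by
  obtain ⟨e, he⟩ := h
  refine ⟨e.symm, LinearMap.ext fun w => e.injective ?_⟩
  have := LinearMap.congr_fun he (e.symm w)
  simp at this ⊢
  exact this.symm

theorem Iso.trans {U V W : NilMod F} (h : Iso U V) (h' : Iso V W) : Iso U W := by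
  obtain ⟨e, he⟩ := h
  obtain ⟨e', he'⟩ := h'
  refine ⟨e.trans e', LinearMap.ext fun w => ?_⟩
  have h1 := LinearMap.congr_fun he w
  have h2 := LinearMap.congr_fun he' (e w)
  simp at h1 h2 ⊢
  rw [h1, h2]

instance setoid (F : Type u) [Field F] : Setoid (NilMod F) where
  r := Iso
  iseqv := ⟨Iso.refl, Iso.symm, Iso.trans⟩

/-- The direct sum `V ⊕ W`. -/
def sum (V W : NilMod F) : NilMod F where
  carrier := V.carrier × W.carrier
  T := V.T.prodMap W.T
  nilpotent := by
    obtain ⟨m, hm⟩ := V.nilpotent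
    obtain ⟨n, hn⟩ := W.nilpotent
    have key : ∀ k : ℕ, V.T.prodMap W.T ^ k = (V.T ^ k).prodMap (W.T ^ k) := fun k => by
      induction k with
      | zero => rfl
      | succ k ih => rw [pow_succ, ih, pow_succ, pow_succ, LinearMap.prodMap_mul]
    refine ⟨m + n, ?_⟩
    rw [key, pow_add, hm, pow_add, hn, zero_mul, mul_zero, LinearMap.prodMap_zero]

/-- The tensor product `V ⊗_F W`, with `T` acting by `T_V ⊗ id + id ⊗ T_W`. -/
def tensor (V W : NilMod F) : NilMod F where
  carrier := V.carrier ⊗[F] W.carrier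
  T := TensorProduct.map V.T LinearMap.id + TensorProduct.map LinearMap.id W.T
  nilpotent := by
    refine Commute.isNilpotent_add ?_ ?_ ?_
    · change _ * _ = _ * _
      rw [← TensorProduct.map_mul, ← TensorProduct.map_mul]
      rfl
    · obtain ⟨m, hm⟩ := V.nilpotent
      exact ⟨m, by rw [TensorProduct.map_pow, hm, TensorProduct.map_zero_left]⟩
    · obtain ⟨m, hm⟩ := W.nilpotent
      exact ⟨m, by rw [TensorProduct.map_pow, hm, TensorProduct.map_zero_right]⟩

/-- The one-dimensional module `F`, with `T = 0`. -/
def unit (F : Type u) [Field F] : NilMod F where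
  carrier := F
  T := 0
  nilpotent := IsNilpotent.zero

/-- The cyclic module `F[T] / (T ^ r)`. -/
def cyclic (F : Type u) [Field F] (r : ℕ) : NilMod F where
  carrier := Polynomial F ⧸ Ideal.span {(Polynomial.X : Polynomial F) ^ r}
  finite := (Polynomial.monic_X_pow r).finite_quotient
  T := LinearMap.mulLeft F
    (Ideal.Quotient.mk (Ideal.span {(Polynomial.X : Polynomial F) ^ r}) Polynomial.X)
  nilpotent := by
    refine ⟨r, ?_⟩
    rw [LinearMap.pow_mulLeft, ← map_pow,
      Ideal.Quotient.eq_zero_iff_mem.2 (Ideal.mem_span_singleton_self _), LinearMap.mulLeft_zero_eq_zero]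

theorem Iso.sum {V V' W W' : NilMod F} (h : Iso V V') (h' : Iso W W') :
    Iso (V.sum W) (V'.sum W') := by
  obtain ⟨e, he⟩ := h
  obtain ⟨e', he'⟩ := h'
  refine ⟨e.prodCongr e', LinearMap.ext fun x => ?_⟩
  exact Prod.ext (LinearMap.congr_fun he x.1) (LinearMap.congr_fun he' x.2)

theorem Iso.tensor {V V' W W' : NilMod F} (h : Iso V V') (h' : Iso W W') :
    Iso (V.tensor W) (V'.tensor W') := by
  obtain ⟨e, he⟩ := h
  obtain ⟨e', he'⟩ := h'
  refine ⟨TensorProduct.congr e e', TensorProduct.ext' fun x y => ?_⟩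
  have h1 : e (V.T x) = V'.T (e x) := LinearMap.congr_fun he x
  have h2 : e' (W.T y) = W'.T (e' y) := LinearMap.congr_fun he' y
  change TensorProduct.congr e e' (V.T x ⊗ₜ[F] y + x ⊗ₜ[F] W.T y)
    = V'.T (e x) ⊗ₜ[F] e' y + e x ⊗ₜ[F] W'.T (e' y)
  simp [h1, h2]

theorem tensor_comm (V W : NilMod F) : Iso (V.tensor W) (W.tensor V) :=
  ⟨TensorProduct.comm F _ _, TensorProduct.ext' fun x y => by
    change TensorProduct.comm F V.carrier W.carrier (V.T x ⊗ₜ[F] y + x ⊗ₜ[F] W.T y)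
      = W.T y ⊗ₜ[F] x + y ⊗ₜ[F] V.T x
    simp [add_comm]⟩

theorem tensor_assoc (U V W : NilMod F) :
    Iso ((U.tensor V).tensor W) (U.tensor (V.tensor W)) :=
  ⟨TensorProduct.assoc F _ _ _, TensorProduct.ext_threefold fun x y z => by
    change TensorProduct.assoc F U.carrier V.carrier W.carrier
        ((U.T x ⊗ₜ[F] y + x ⊗ₜ[F] V.T y) ⊗ₜ[F] z + (x ⊗ₜ[F] y) ⊗ₜ[F] W.T z)
      = U.T x ⊗ₜ[F] (y ⊗ₜ[F] z) + x ⊗ₜ[F] (V.T y ⊗ₜ[F] z + y ⊗ₜ[F] W.T z)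
    simp [TensorProduct.add_tmul, TensorProduct.tmul_add, add_assoc]⟩

theorem unit_tensor (V : NilMod F) : Iso ((unit F).tensor V) V :=
  ⟨TensorProduct.lid F _, TensorProduct.ext' fun (x : F) y => by
    change TensorProduct.lid F V.carrier ((0 : F) ⊗ₜ[F] y + x ⊗ₜ[F] V.T y) = V.T (x • y)
    simp⟩

theorem sum_tensor (U V W : NilMod F) :
    Iso ((U.sum V).tensor W) ((U.tensor W).sum (V.tensor W)) := by
  refine ⟨TensorProduct.prodLeft F F U.carrier V.carrier W.carrier, TensorProduct.ext' ?_⟩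
  rintro ⟨x, y⟩ z
  change TensorProduct.prodLeft F F U.carrier V.carrier W.carrier
      ((U.T x, V.T y) ⊗ₜ[F] z + (x, y) ⊗ₜ[F] W.T z)
    = (U.T x ⊗ₜ[F] z + x ⊗ₜ[F] W.T z, V.T y ⊗ₜ[F] z + y ⊗ₜ[F] W.T z)
  rw [map_add, TensorProduct.prodLeft_tmul, TensorProduct.prodLeft_tmul]
  rfl

end NilMod

/-- Isomorphism classes of finitely generated `T`-power-torsion `F[T]`-modules. -/
def NilClass (F : Type u) [Field F] : Type (u + 1) := Quotient (NilMod.setoid F)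

namespace NilClass

variable {F : Type u} [Field F]

/-- Direct sum of isomorphism classes. -/
def sum : NilClass F → NilClass F → NilClass F :=
  Quotient.map₂ NilMod.sum fun _ _ h _ _ h' => NilMod.Iso.sum h h'

/-- Isomorphism classes form a commutative monoid under the tensor product over `F`. -/
instance : CommMonoid (NilClass F) where
  mul := Quotient.map₂ NilMod.tensor fun _ _ h _ _ h' => NilMod.Iso.tensor h h'
  one := Quotient.mk _ (NilMod.unit F)
  mul_assoc := by
    rintro ⟨U⟩ ⟨V⟩ ⟨W⟩
    exact Quotient.sound (NilMod.tensor_assoc U V W)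
  mul_comm := by
    rintro ⟨V⟩ ⟨W⟩
    exact Quotient.sound (NilMod.tensor_comm V W)
  one_mul := by
    rintro ⟨V⟩
    exact Quotient.sound (NilMod.unit_tensor V)
  mul_one := by
    rintro ⟨V⟩
    exact Quotient.sound ((NilMod.tensor_comm V (NilMod.unit F)).trans (NilMod.unit_tensor V))

end NilClass

/-- The Grothendieck relations `[V ⊕ W] - [V] - [W]`. They are stable under multiplication by
classes, since the tensor product distributes over direct sums (`NilMod.sum_tensor`), so that the ideal they generate
is just the subgroup they generate. -/
def grothendieckIdeal (F : Type u) [Field F] : Ideal (FreeAbelianGroup (NilClass F)) :=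
  Ideal.span {x | ∃ V W : NilClass F, x = FreeAbelianGroup.of (V.sum W)
    - FreeAbelianGroup.of V - FreeAbelianGroup.of W}

/-- The Grothendieck ring `Γ`: the free abelian group on the isomorphism classes, modulo
`[V ⊕ W] = [V] + [W]`, with the product `[V] [W] = [V ⊗_F W]`. -/
abbrev Gamma (F : Type u) [Field F] : Type (u + 1) :=
  FreeAbelianGroup (NilClass F) ⧸ grothendieckIdeal F

/-- The class of a module in `Γ`. -/
def Gamma.cls {F : Type u} [Field F] (V : NilMod F) : Gamma F :=
  Ideal.Quotient.mk (grothendieckIdeal F)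
    (FreeAbelianGroup.of (Quotient.mk (NilMod.setoid F) V : NilClass F))

/-- `λ_i = (-1) ^ i ([F[T] / T ^ (i + 1)] - [F[T] / T ^ i])`. This is the only family such that
`[V] = ∑ i, (-1) ^ i dim (T ^ i V / T ^ (i + 1) V) λ_i` for all `V`: apply this to the cyclic
modules, for which it says `[F[T] / T ^ r] = ∑ i < r, (-1) ^ i λ_i`. -/
def Gamma.lam (F : Type u) [Field F] (i : ℕ) : Gamma F :=
  (-1) ^ i * (Gamma.cls (NilMod.cyclic F (i + 1)) - Gamma.cls (NilMod.cyclic F i))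

/-- `Γ_ℚ = Γ ⊗_ℤ ℚ`. -/
abbrev GammaQ (F : Type u) [Field F] : Type (u + 1) := Gamma F ⊗[ℤ] ℚ

/-- `L_n (α) = ∑_{i < q} (α ((i + 1) / q) - α (i / q)) (-1) ^ i λ_i`, with `q = 2 ^ n`. -/
def scriptL (F : Type u) [Field F] (n : ℕ) (α : DyadicFun) : GammaQ F :=
  ∑ i : Fin (2 ^ n), Gamma.lam F i ⊗ₜ[ℤ]
    ((α (DyadicI.node n (i + 1) i.2) - α (DyadicI.node n i i.2.le)) * (-1) ^ (i : ℕ))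

end

noncomputable section

universe u

/-! ### Rank jumps of nilpotent endomorphisms -/

/-! Write δ_m for the class of F[T]/T^m and μ_i = δ_{i+1} - δ_i. The signs in the definition of L_n
cancel, so L_n(α) is the combination of the μ_i with i < q = 2^n whose coefficients are the
successive differences of α. Every class is [V] = ∑ jump_k(V) μ_k, where jump_k(V) = dim T^k V /
T^{k+1} V (`Gamma.cls_eq_sum_jump`).

Part 1. Let M_f be F[[u]]/(u^q) with T acting as f. Its jumps are the differences of the colengths
of (u^q, f^i), so L_n(φ_f) = q^{-r} [M_f] (`scriptL_phi`). Multiplication gives M_f ⊗ M_g ≅ M_h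
(`truncMod_tensor_iso`), hence multiplicativity.

Part 2. In characteristic 2, μ_q μ_i = μ_{q+i} for i < q, and μ_q² = 1. Splitting [0,1] in half
therefore gives L_{n+1}(α) = L_n(α₀) + μ_q L_n(α₁), and the recursion defining # is precisely
multiplication of such expressions: L_n(α # β) = L_n(α) L_n(β) (`scriptL_sharp`). The jump
functionals recover the differences of α from L_n(α), so a function is determined by its value at 0
and all its L_n (`eq_of_scriptL_eq`). Both φ_h and φ_f # φ_g vanish at 0 and have the same L_n, by
part 1.

The relations between the μ_i come from δ_q [W] = dim(W) δ_q, when T^q kills W, and δ_{q-1} δ_j =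
(j-1) δ_q + δ_{q-j}. Together they give μ_{q-1} μ_j = μ_{q-1-j}. Both are found by bounding the
jumps of a tensor product and comparing with its dimension, with no explicit decomposition. -/

theorem LinearMap.prodMap_pow {R M N : Type*} [CommRing R] [AddCommGroup M] [Module R M]
    [AddCommGroup N] [Module R N] (f : Module.End R M) (g : Module.End R N) (k : ℕ) :
    (f.prodMap g : Module.End R (M × N)) ^ k = (f ^ k).prodMap (g ^ k) := by
  induction k with
  | zero => rfl
  | succ k ih => rw [pow_succ, ih, pow_succ, pow_succ, LinearMap.prodMap_mul]

theorem LinearMap.finrank_range_prodMap {K M N M' N' : Type*} [Field K] [AddCommGroup M]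
    [Module K M] [AddCommGroup N] [Module K N] [AddCommGroup M'] [Module K M'] [AddCommGroup N']
    [Module K N'] [FiniteDimensional K M'] [FiniteDimensional K N']
    (f : M →ₗ[K] M') (g : N →ₗ[K] N') :
    Module.finrank K (LinearMap.range (f.prodMap g)) =
      Module.finrank K (LinearMap.range f) + Module.finrank K (LinearMap.range g) := by
  have h : LinearMap.range (f.prodMap g) =
      LinearMap.range ((LinearMap.range f).subtype.prodMap (LinearMap.range g).subtype) := by
    simp only [LinearMap.range_prodMap, Submodule.range_subtype]
  rw [h, LinearMap.finrank_range_of_inj, Module.finrank_prod]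
  exact (Submodule.subtype_injective _).prodMap (Submodule.subtype_injective _)

namespace NilMod

variable {F : Type u} [Field F]

/-- The rank of `T ^ k`. -/
def rk (V : NilMod F) (k : ℕ) : ℕ := Module.finrank F (LinearMap.range (V.T ^ k))

/-- The dimension of `T ^ k V / T ^ (k + 1) V`. -/
def jump (V : NilMod F) (k : ℕ) : ℤ := V.rk k - V.rk (k + 1)

/-- The dimension of the underlying vector space. -/
def dim (V : NilMod F) : ℕ := Module.finrank F V.carrier

theorem rk_zero (V : NilMod F) : V.rk 0 = V.dim := by
  rw [rk, pow_zero, Module.End.one_eq_id, LinearMap.range_id, finrank_top, dim]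

theorem rk_eq_zero {V : NilMod F} {k : ℕ} (h : V.T ^ k = 0) : V.rk k = 0 := by
  rw [rk, h, LinearMap.range_zero, finrank_bot]

/-- Rank-nullity for T restricted to T^k V. In this form the jumps visibly decrease with k. -/
theorem jump_eq_finrank_inf (V : NilMod F) (k : ℕ) :
    V.jump k = Module.finrank F ↥(LinearMap.range (V.T ^ k) ⊓ LinearMap.ker V.T) := by
  have h := LinearMap.finrank_range_add_finrank_ker
    (V.T.domRestrict (LinearMap.range (V.T ^ k)))
  rw [LinearMap.range_domRestrict, LinearMap.ker_domRestrict, ← LinearMap.range_comp] at h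
  have h2 : Module.finrank F ↥((LinearMap.ker V.T).submoduleOf (LinearMap.range (V.T ^ k)))
      = Module.finrank F ↥(LinearMap.range (V.T ^ k) ⊓ LinearMap.ker V.T) := by
    rw [← Submodule.map_comap_subtype]
    exact (Submodule.equivMapOfInjective _ (Submodule.subtype_injective _) _).finrank_eq
  rw [Submodule.submoduleOf] at h2
  rw [h2] at h
  rw [jump, rk, rk, pow_succ', Module.End.mul_eq_comp]
  omega

theorem jump_antitone (V : NilMod F) : Antitone V.jump := by
  refine antitone_nat_of_succ_le fun k => ?_
  rw [jump_eq_finrank_inf, jump_eq_finrank_inf]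
  refine Nat.cast_le.2 (Submodule.finrank_mono (inf_le_inf_right _ ?_))
  rw [pow_succ, Module.End.mul_eq_comp]
  exact LinearMap.range_comp_le_range _ _

theorem sum_jump (V : NilMod F) (N : ℕ) :
    ∑ k ∈ Finset.range N, V.jump k = V.dim - V.rk N := by
  rw [← rk_zero]
  exact Finset.sum_range_sub' (fun k => (V.rk k : ℤ)) N

theorem sum_jump_of_pow_eq_zero {V : NilMod F} {N : ℕ} (h : V.T ^ N = 0) :
    ∑ k ∈ Finset.range N, V.jump k = V.dim := by
  rw [sum_jump, rk_eq_zero h, Nat.cast_zero, sub_zero]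

theorem jump_eq_zero {V : NilMod F} {N k : ℕ} (h : V.T ^ N = 0) (hk : N ≤ k) : V.jump k = 0 := by
  rw [jump, rk_eq_zero (pow_eq_zero_of_le hk h), rk_eq_zero (pow_eq_zero_of_le (by omega) h),
    sub_self]

theorem Iso.apply_pow {V W : NilMod F} {e : V.carrier ≃ₗ[F] W.carrier}
    (he : e.toLinearMap ∘ₗ V.T = W.T ∘ₗ e.toLinearMap) (k : ℕ) :
    e.toLinearMap ∘ₗ (V.T ^ k) = (W.T ^ k) ∘ₗ e.toLinearMap := by
  induction k with
  | zero => rfl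
  | succ k ih =>
    rw [pow_succ, pow_succ, Module.End.mul_eq_comp, Module.End.mul_eq_comp,
      ← LinearMap.comp_assoc, ih, LinearMap.comp_assoc, he, LinearMap.comp_assoc]

theorem Iso.rk_eq {V W : NilMod F} (h : Iso V W) (k : ℕ) : V.rk k = W.rk k := by
  obtain ⟨e, he⟩ := h
  have h1 : LinearMap.range (e.toLinearMap ∘ₗ (V.T ^ k)) = LinearMap.range (W.T ^ k) := by
    rw [Iso.apply_pow he k]
    exact LinearEquiv.range_comp e _
  rw [rk, rk, ← h1, LinearMap.range_comp]
  exact (LinearEquiv.finrank_map_eq e _).symm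

theorem Iso.jump_eq {V W : NilMod F} (h : Iso V W) (k : ℕ) : V.jump k = W.jump k := by
  rw [jump, jump, h.rk_eq, h.rk_eq]

theorem rk_sum (V W : NilMod F) (k : ℕ) : (V.sum W).rk k = V.rk k + W.rk k := by
  have h : (V.sum W).rk k = Module.finrank F (LinearMap.range (V.T.prodMap W.T ^ k)) := rfl
  rw [h, LinearMap.prodMap_pow, LinearMap.finrank_range_prodMap]
  rfl

theorem jump_sum (V W : NilMod F) (k : ℕ) : (V.sum W).jump k = V.jump k + W.jump k := by
  simp only [jump, rk_sum]
  push_cast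
  ring

end NilMod

/-! ### The jump functionals on Γ -/

namespace Gamma
variable {F : Type u} [Field F]

/-- `V ↦ dim (T ^ k V / T ^ (k + 1) V)` on isomorphism classes. -/
def classJump (k : ℕ) : NilClass F → ℤ :=
  Quotient.lift (fun V : NilMod F => V.jump k) fun _ _ h => NilMod.Iso.jump_eq h k

theorem classJump_sum (k : ℕ) (V W : NilClass F) :
    classJump k (V.sum W) = classJump k V + classJump k W := by
  induction V using Quotient.inductionOn
  induction W using Quotient.inductionOn
  exact NilMod.jump_sum _ _ k

theorem _root_.NilClass.mul_sum (U V W : NilClass F) : U * V.sum W = (U * V).sum (U * W) := by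
  rw [mul_comm U, mul_comm U, mul_comm U]
  induction U using Quotient.inductionOn
  induction V using Quotient.inductionOn
  induction W using Quotient.inductionOn
  exact Quotient.sound (NilMod.sum_tensor _ _ _)

/-- The functional is only additive, so vanishing on the generators of the ideal is not enough. The
vanishing is proved for all multiples y * x at once, using that a class times a Grothendieck
relation is again such a relation. -/
theorem lift_classJump_eq_zero (k : ℕ) {x : FreeAbelianGroup (NilClass F)}
    (hx : x ∈ grothendieckIdeal F) : FreeAbelianGroup.lift (classJump k) x = 0 := by
  suffices h : ∀ y, FreeAbelianGroup.lift (classJump k) (y * x) = 0 by simpa using h 1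
  refine Submodule.span_induction (p := fun x _ => ∀ y,
    FreeAbelianGroup.lift (classJump k) (y * x) = 0) ?_ ?_ ?_ ?_ hx
  · rintro _ ⟨V, W, rfl⟩ y
    induction y using FreeAbelianGroup.induction_on with
    | zero => simp
    | of U =>
      simp only [mul_sub, ← FreeAbelianGroup.of_mul, map_sub, FreeAbelianGroup.lift_apply_of,
        NilClass.mul_sum, classJump_sum]
      ring
    | neg U ih => rw [neg_mul, map_neg, ih, neg_zero]
    | add x y ihx ihy => rw [add_mul, map_add, ihx, ihy, add_zero]
  · simp
  · intro a b _ _ ha hb y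
    rw [mul_add, map_add, ha, hb, add_zero]
  · intro a b _ hb y
    rw [smul_eq_mul, ← mul_assoc, hb]

/-- The additive functional `[V] ↦ dim (T ^ k V / T ^ (k + 1) V)` on `Γ`. -/
def jump (F : Type u) [Field F] (k : ℕ) : Gamma F →+ ℤ :=
  QuotientAddGroup.lift (grothendieckIdeal F).toAddSubgroup (FreeAbelianGroup.lift (classJump k))
    fun _ hx => lift_classJump_eq_zero k hx

theorem jump_cls (k : ℕ) (V : NilMod F) : jump F k (cls V) = V.jump k := by
  exact FreeAbelianGroup.lift_apply_of (classJump k) _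

theorem cls_eq {V W : NilMod F} (h : V.Iso W) : cls V = cls W := by
  rw [cls, cls, Quotient.sound (s := NilMod.setoid F) h]

theorem cls_sum (V W : NilMod F) : cls (V.sum W) = cls V + cls W := by
  rw [← sub_eq_zero, ← sub_sub]
  exact Ideal.Quotient.eq_zero_iff_mem.2 (Ideal.subset_span ⟨_, _, rfl⟩)

theorem cls_tensor (V W : NilMod F) : cls (V.tensor W) = cls V * cls W := by
  exact (congrArg (Ideal.Quotient.mk (grothendieckIdeal F))
    (FreeAbelianGroup.of_mul (α := NilClass F) (Quotient.mk (NilMod.setoid F) V)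
      (Quotient.mk (NilMod.setoid F) W))).trans (map_mul _ _ _)

theorem cls_unit : cls (NilMod.unit F) = 1 := rfl

end Gamma

/-! ### Cyclic modules and the structure theorem -/

namespace NilMod

variable {F : Type u} [Field F]

/-- S maps onto V / TV. Since jumps decrease, a bound on the number of generators bounds every jump.
-/
theorem jump_zero_le {V : NilMod F} {S : Submodule F V.carrier}
    (h : LinearMap.range V.T ⊔ S = ⊤) : V.jump 0 ≤ Module.finrank F S := by
  have h1 := Submodule.finrank_add_le_finrank_add_finrank (LinearMap.range V.T) S
  rw [h, finrank_top] at h1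
  rw [jump, rk_zero, zero_add, rk, pow_one, dim]
  omega

theorem dim_cyclic (m : ℕ) : (cyclic F m).dim = m := by
  rw [dim]
  refine finrank_quotient_span_eq_natDegree.trans ?_
  exact Polynomial.natDegree_X_pow m

/-- The projection of `F[T]` onto the cyclic module. -/
def cyclicMk (F : Type u) [Field F] (m : ℕ) : Polynomial F →ₗ[F] (cyclic F m).carrier :=
  (Ideal.Quotient.mkₐ F (Ideal.span {(Polynomial.X : Polynomial F) ^ m})).toLinearMap

theorem cyclicMk_surjective (m : ℕ) : Function.Surjective (cyclicMk F m) :=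
  Ideal.Quotient.mk_surjective

theorem cyclic_T_mk (m : ℕ) (p : Polynomial F) :
    (cyclic F m).T (cyclicMk F m p) = cyclicMk F m (Polynomial.X * p) :=
  (map_mul (Ideal.Quotient.mk (Ideal.span {(Polynomial.X : Polynomial F) ^ m})) _ _).symm

theorem cyclic_T_pow_mk (m k : ℕ) (p : Polynomial F) :
    ((cyclic F m).T ^ k) (cyclicMk F m p) = cyclicMk F m (Polynomial.X ^ k * p) := by
  induction k with
  | zero => rw [pow_zero, pow_zero, one_mul]; rfl
  | succ k ih => rw [pow_succ', Module.End.mul_apply, ih, cyclic_T_mk, pow_succ', mul_assoc]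

theorem cyclic_T_pow (m : ℕ) : (cyclic F m).T ^ m = 0 := by
  refine LinearMap.ext fun x => ?_
  obtain ⟨p, rfl⟩ := cyclicMk_surjective m x
  rw [cyclic_T_pow_mk]
  exact Ideal.Quotient.eq_zero_iff_mem.2
    (Ideal.mul_mem_right _ _ (Ideal.mem_span_singleton_self _))

/-- The generator of the cyclic module. -/
def cyclicOne (F : Type u) [Field F] (m : ℕ) : (cyclic F m).carrier := cyclicMk F m 1

/-- The cyclic module is spanned by the images of its generator under the powers of `T`. -/
theorem cyclic_induction {m : ℕ} {P : (cyclic F m).carrier → Prop}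
    (pow : ∀ k, P (((cyclic F m).T ^ k) (cyclicOne F m)))
    (add : ∀ x y, P x → P y → P (x + y)) (smul : ∀ (c : F) x, P x → P (c • x))
    (x : (cyclic F m).carrier) : P x := by
  obtain ⟨p, rfl⟩ := cyclicMk_surjective m x
  induction p using Polynomial.induction_on' with
  | add p q hp hq => rw [map_add]; exact add _ _ hp hq
  | monomial n a =>
    have h := smul a _ (pow n)
    rwa [cyclicOne, cyclic_T_pow_mk, mul_one, ← map_smul, Polynomial.smul_X_eq_monomial] at h

/-- One generator makes every jump at most 1, and the first m jumps add up to the dimension m, so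
each of them is 1. -/
theorem jump_cyclic (m k : ℕ) : (cyclic F m).jump k = if k < m then 1 else 0 := by
  split_ifs with hk
  · have h0 : (cyclic F m).jump 0 ≤ 1 := by
      have h : LinearMap.range (cyclic F m).T ⊔ Submodule.span F {cyclicOne F m} = ⊤ := by
        refine eq_top_iff.2 fun x _ => ?_
        induction x using cyclic_induction with
        | pow k =>
          cases k with
          | zero => exact Submodule.mem_sup_right (Submodule.mem_span_singleton_self _)
          | succ k =>
            rw [pow_succ', Module.End.mul_apply]
            exact Submodule.mem_sup_left ⟨_, rfl⟩
        | add x y hx hy => exact add_mem (hx trivial) (hy trivial)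
        | smul c x hx => exact Submodule.smul_mem _ _ (hx trivial)
      refine (jump_zero_le h).trans ?_
      exact_mod_cast (finrank_span_le_card _).trans_eq (Set.toFinset_card _)
    have h1 : ∀ j, (cyclic F m).jump j ≤ 1 := fun j => (jump_antitone _ (Nat.zero_le j)).trans h0
    have h2 := sum_jump_of_pow_eq_zero (cyclic_T_pow (F := F) m)
    rw [dim_cyclic] at h2
    by_contra hne
    have h3 : ∑ j ∈ Finset.range m, (cyclic F m).jump j < ∑ j ∈ Finset.range m, 1 :=
      Finset.sum_lt_sum (fun j _ => h1 j) ⟨k, Finset.mem_range.2 hk, lt_of_le_of_ne (h1 k) hne⟩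
    simp [h2] at h3
  · exact jump_eq_zero (cyclic_T_pow m) (by omega)

/-- The direct sum of a finite family. -/
def pi {d : ℕ} (W : Fin d → NilMod F) : NilMod F where
  carrier := ∀ i, (W i).carrier
  T := LinearMap.pi fun i => (W i).T ∘ₗ LinearMap.proj i
  nilpotent := by
    choose N hN using fun i => (W i).nilpotent
    have key : ∀ k x i, ((LinearMap.pi fun i => (W i).T ∘ₗ LinearMap.proj i :
        Module.End F (∀ i, (W i).carrier)) ^ k) x i = ((W i).T ^ k) (x i) := fun k => by
      induction k with
      | zero => exact fun _ _ => rfl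
      | succ k ih => intro x i; rw [pow_succ, Module.End.mul_apply, ih, pow_succ]; rfl
    refine ⟨∑ i, N i, LinearMap.ext fun x => funext fun i => ?_⟩
    rw [key, pow_eq_zero_of_le (Finset.single_le_sum (fun _ _ => Nat.zero_le _)
      (Finset.mem_univ i)) (hN i)]
    rfl

theorem sum_iso_pi {d : ℕ} (W : Fin (d + 1) → NilMod F) :
    Iso ((W 0).sum (pi fun i => W i.succ)) (pi W) := by
  refine ⟨Fin.consLinearEquiv F fun i => (W i).carrier, LinearMap.ext fun x => ?_⟩
  refine funext fun i => ?_
  refine Fin.cases rfl (fun i => rfl) i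

/-- The structure theorem for torsion modules over the principal ideal domain F[T], applied at the
prime T. -/
theorem exists_iso_pi (V : NilMod F) :
    ∃ (d : ℕ) (k : Fin d → ℕ), Iso V (pi fun i => cyclic F (k i)) := by
  obtain ⟨N, hN⟩ := V.nilpotent
  have htors : Module.IsTorsion' (Module.AEval' V.T)
      (Submonoid.powers (Polynomial.X : Polynomial F)) := by
    intro x
    refine ⟨⟨_, N, rfl⟩, ?_⟩
    obtain ⟨v, rfl⟩ := (Module.AEval'.of V.T).surjective x
    refine (Module.AEval'.X_pow_smul_of V.T v N).trans ?_
    rw [hN]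
    exact (congrArg _ (LinearMap.zero_apply v)).trans (map_zero _)
  obtain ⟨d, k, ⟨e⟩⟩ := Module.torsion_by_prime_power_decomposition Polynomial.irreducible_X htors
  refine ⟨d, k, ?_⟩
  let e1 : V.carrier ≃ₗ[F] (pi fun i => cyclic F (k i)).carrier :=
    (Module.AEval'.of V.T).trans ((e.trans
      (DirectSum.linearEquivFunOnFintype (Polynomial F) (Fin d) _)).restrictScalars F)
  refine ⟨e1, LinearMap.ext fun v => ?_⟩
  have h : Module.AEval'.of V.T (V.T v) = (Polynomial.X : Polynomial F) • Module.AEval'.of V.T v :=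
    (Module.AEval'.X_smul_of V.T v).symm
  change (e.trans (DirectSum.linearEquivFunOnFintype (Polynomial F) (Fin d) _))
    (Module.AEval'.of V.T (V.T v)) = _
  rw [h, map_smul]
  rfl

end NilMod

/-! ### Expansion of classes in the μ_i -/

namespace Gamma

variable {F : Type u} [Field F]

/-- V ≅ V ⊕ V, so [V] = 2[V]. -/
theorem cls_eq_zero (V : NilMod F) [Subsingleton V.carrier] : cls V = 0 := by
  have : Subsingleton (V.sum V).carrier := inferInstanceAs (Subsingleton (V.carrier × V.carrier))
  have h : V.Iso (V.sum V) :=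
    ⟨{ (0 : V.carrier →ₗ[F] (V.sum V).carrier) with
        invFun := 0, left_inv := fun _ => Subsingleton.elim _ _
        right_inv := fun _ => Subsingleton.elim _ _ }, LinearMap.ext fun _ => Subsingleton.elim _ _⟩
  have h2 := cls_eq h
  rw [cls_sum] at h2
  exact left_eq_add.1 h2

theorem cls_pi {d : ℕ} (W : Fin d → NilMod F) : cls (NilMod.pi W) = ∑ i, cls (W i) := by
  induction d with
  | zero =>
    have : Subsingleton (NilMod.pi W).carrier :=
      inferInstanceAs (Subsingleton (∀ i, (W i).carrier))
    rw [cls_eq_zero, Fin.sum_univ_zero]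
  | succ d ih => rw [← cls_eq (NilMod.sum_iso_pi W), cls_sum, ih, Fin.sum_univ_succ]

/-- `[F[T] / T ^ (i + 1)] - [F[T] / T ^ i]`. -/
def mu (F : Type u) [Field F] (i : ℕ) : Gamma F :=
  cls (NilMod.cyclic F (i + 1)) - cls (NilMod.cyclic F i)

theorem lam_eq (i : ℕ) : lam F i = (-1) ^ i * mu F i := rfl

theorem cls_cyclic_zero : cls (NilMod.cyclic F 0) = 0 := by
  have : Subsingleton (NilMod.cyclic F 0).carrier :=
    Module.finrank_zero_iff.1 (NilMod.dim_cyclic (F := F) 0)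
  exact cls_eq_zero _

theorem cls_cyclic_one : cls (NilMod.cyclic F 1) = 1 := by
  have hd : Module.finrank F (NilMod.cyclic F 1).carrier
      = Module.finrank F (NilMod.unit F).carrier :=
    (NilMod.dim_cyclic 1).trans (Module.finrank_self F).symm
  rw [← cls_unit]
  refine cls_eq ⟨LinearEquiv.ofFinrankEq _ _ hd, ?_⟩
  have h1 : (NilMod.cyclic F 1).T = 0 := by simpa using NilMod.cyclic_T_pow (F := F) 1
  have h2 : (NilMod.unit F).T = 0 := rfl
  rw [h1, h2, LinearMap.comp_zero, LinearMap.zero_comp]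

theorem mu_zero : mu F 0 = 1 := by
  rw [mu, zero_add, cls_cyclic_zero, cls_cyclic_one, sub_zero]

theorem sum_mu (m : ℕ) : ∑ i ∈ Finset.range m, mu F i = cls (NilMod.cyclic F m) := by
  simp only [mu]
  rw [Finset.sum_range_sub (fun i => cls (NilMod.cyclic F i)), cls_cyclic_zero, sub_zero]

theorem jump_mu (k i : ℕ) : jump F k (mu F i) = if k = i then 1 else 0 := by
  rw [mu, map_sub, jump_cls, jump_cls, NilMod.jump_cyclic, NilMod.jump_cyclic]
  split_ifs <;> omega

/-- `[V] = ∑ k, dim (T ^ k V / T ^ (k + 1) V) ([F[T] / T ^ (k + 1)] - [F[T] / T ^ k])`. -/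
theorem cls_eq_sum_jump {V : NilMod F} {N : ℕ} (hN : V.T ^ N = 0) :
    cls V = ∑ k ∈ Finset.range N, V.jump k • mu F k := by
  obtain ⟨d, m, h⟩ := V.exists_iso_pi
  have hV : cls V = ∑ i, cls (NilMod.cyclic F (m i)) := by rw [cls_eq h, cls_pi]
  have hj : ∀ k, V.jump k = ∑ i, if k < m i then 1 else 0 := fun k => by
    rw [← jump_cls, hV, map_sum]
    simp only [jump_cls, NilMod.jump_cyclic]
  -- The jump at N counts the summands with m i > N, and it is zero because T^N = 0.
  have hm : ∀ i, m i ≤ N := fun i => by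
    by_contra hlt
    have h0 := hj N
    rw [NilMod.jump_eq_zero hN le_rfl] at h0
    have h1 := (Finset.sum_eq_zero_iff_of_nonneg
      (fun i _ => by split_ifs <;> simp)).1 h0.symm i (Finset.mem_univ i)
    simp at h1
    omega
  simp only [hV, hj, Finset.sum_smul]
  rw [Finset.sum_comm]
  refine Finset.sum_congr rfl fun i _ => ?_
  rw [← sum_mu, ← Finset.sum_subset (Finset.range_subset_range.2 (hm i))]
  · refine Finset.sum_congr rfl fun k hk => ?_
    rw [if_pos (Finset.mem_range.1 hk), one_smul]
  · intro k _ hk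
    rw [if_neg (fun h => hk (Finset.mem_range.2 h)), zero_smul]

end Gamma

/-! ### Jumps of tensor products with cyclic modules -/

namespace NilMod

variable {F : Type u} [Field F]

/-- Pure tensors. -/
def tmul (V W : NilMod F) : V.carrier →ₗ[F] W.carrier →ₗ[F] (V.tensor W).carrier :=
  TensorProduct.mk F V.carrier W.carrier

theorem dim_tensor (V W : NilMod F) : (V.tensor W).dim = V.dim * W.dim :=
  Module.finrank_tensorProduct (R := F) (S := F)

theorem tensor_T_tmul (V W : NilMod F) (x : V.carrier) (w : W.carrier) :
    (V.tensor W).T (tmul V W x w) = tmul V W (V.T x) w + tmul V W x (W.T w) := rfl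

theorem tensor_hom_ext {V W : NilMod F} {M : Type*} [AddCommGroup M] [Module F M]
    {f g : (V.tensor W).carrier →ₗ[F] M} (h : ∀ x w, f (tmul V W x w) = g (tmul V W x w)) :
    f = g :=
  TensorProduct.ext' h

theorem tensor_induction {V W : NilMod F} {S : Submodule F (V.tensor W).carrier}
    (h : ∀ x w, tmul V W x w ∈ S) : S = ⊤ :=
  eq_top_iff.2 fun z _ => TensorProduct.induction_on (motive := fun z => z ∈ S) z S.zero_mem h
    fun _ _ => S.add_mem

theorem tensor_T_pow_tmul (V W : NilMod F) (n : ℕ) (x : V.carrier) (w : W.carrier) :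
    ((V.tensor W).T ^ n) (tmul V W x w) = ∑ k ∈ Finset.range (n + 1),
      n.choose k • tmul V W ((V.T ^ k) x) ((W.T ^ (n - k)) w) := by
  have hc : Commute (TensorProduct.map V.T (LinearMap.id : W.carrier →ₗ[F] W.carrier))
      (TensorProduct.map (LinearMap.id : V.carrier →ₗ[F] V.carrier) W.T) := by
    change _ * _ = _ * _
    rw [← TensorProduct.map_mul, ← TensorProduct.map_mul]
    rfl
  have h := LinearMap.congr_fun (hc.add_pow n) (x ⊗ₜ w)
  refine h.trans ?_
  rw [LinearMap.sum_apply]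
  refine Finset.sum_congr rfl fun k _ => ?_
  rw [← nsmul_eq_mul', LinearMap.smul_apply, TensorProduct.map_pow, TensorProduct.map_pow,
    ← TensorProduct.map_mul, TensorProduct.map_tmul]
  rw [← Module.End.one_eq_id, one_pow, mul_one, ← Module.End.one_eq_id, one_pow, one_mul]
  rfl

/-- The tensor product is generated over F[T] by 1 ⊗ W: modulo the image of T, T^{k+1}1 ⊗ w is -(T^k
1 ⊗ Tw), so all powers of T move to the right factor. -/
theorem jump_cyclic_tensor_le (m : ℕ) (W : NilMod F) (k : ℕ) :
    ((cyclic F m).tensor W).jump k ≤ W.dim := by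
  refine (jump_antitone _ (Nat.zero_le k)).trans ?_
  have h : LinearMap.range ((cyclic F m).tensor W).T ⊔
      LinearMap.range (tmul (cyclic F m) W (cyclicOne F m)) = ⊤ := by
    refine tensor_induction fun x w => ?_
    induction x using cyclic_induction generalizing w with
    | pow k =>
      induction k generalizing w with
      | zero => exact Submodule.mem_sup_right ⟨w, rfl⟩
      | succ k ih =>
        rw [pow_succ', Module.End.mul_apply, ← add_sub_cancel_right (tmul _ _ _ _)
          (tmul _ W (((cyclic F m).T ^ k) (cyclicOne F m)) (W.T w)), ← tensor_T_tmul]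
        exact sub_mem (Submodule.mem_sup_left ⟨_, rfl⟩) (ih _)
    | add x y hx hy => rw [map_add, LinearMap.add_apply]; exact add_mem (hx w) (hy w)
    | smul c x hx => rw [map_smul, LinearMap.smul_apply]; exact Submodule.smul_mem _ _ (hx w)
  refine (jump_zero_le h).trans ?_
  exact_mod_cast LinearMap.finrank_range_le _

/-- The inner binomial coefficients of a power of 2 are even. -/
theorem tensor_T_pow_two_pow [CharP F 2] {V W : NilMod F} {n : ℕ} (hV : V.T ^ 2 ^ n = 0)
    (hW : W.T ^ 2 ^ n = 0) : (V.tensor W).T ^ 2 ^ n = 0 := by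
  refine tensor_hom_ext fun x w => ?_
  rw [tensor_T_pow_tmul, LinearMap.zero_apply]
  refine Finset.sum_eq_zero fun k hk => ?_
  rcases Nat.eq_zero_or_pos k with rfl | h0
  · rw [Nat.sub_zero, hW, LinearMap.zero_apply, map_zero, smul_zero]
  rcases (Nat.lt_succ_iff.1 (Finset.mem_range.1 hk)).eq_or_lt with rfl | h1
  · rw [hV, LinearMap.zero_apply, map_zero, LinearMap.zero_apply, smul_zero]
  obtain ⟨c, hc⟩ := Nat.prime_two.dvd_choose_pow h0.ne' h1.ne
  rw [← Nat.cast_smul_eq_nsmul F, hc, Nat.cast_mul, Nat.cast_two, CharTwo.two_eq_zero, zero_mul,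
    zero_smul]

theorem exists_cyclic_functional (m : ℕ) : ∃ π : (cyclic F (m + 1)).carrier →ₗ[F] F, ∀ k,
    π (((cyclic F (m + 1)).T ^ k) (cyclicOne F (m + 1))) = if k = m then 1 else 0 := by
  let I := Ideal.span {(Polynomial.X : Polynomial F) ^ (m + 1)}
  -- The functional is the coefficient of X^m, which vanishes on multiples of X^{m+1}.
  have hI : I.restrictScalars F ≤ LinearMap.ker (Polynomial.lcoeff F m) := fun p hp => by
    obtain ⟨g, rfl⟩ := Ideal.mem_span_singleton'.1 hp
    rw [LinearMap.mem_ker, Polynomial.lcoeff_apply, Polynomial.coeff_mul_X_pow', if_neg (by omega)]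
  let π : (cyclic F (m + 1)).carrier →ₗ[F] F :=
    ((I.restrictScalars F).liftQ (Polynomial.lcoeff F m) hI) ∘ₗ
      (Submodule.Quotient.restrictScalarsEquiv F I).symm.toLinearMap
  have hπ : ∀ p, π (cyclicMk F (m + 1) p) = p.coeff m := fun p => rfl
  refine ⟨π, fun k => ?_⟩
  rw [cyclicOne, cyclic_T_pow_mk, hπ, mul_one, Polynomial.coeff_X_pow]
  simp only [eq_comm]

/-- The T^m-component of T^{m+1}(1 ⊗ w) is (m+1) Tw, which is Tw because m is even. So the operator
T of W factors through T^{m+1} on the tensor product. -/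
theorem rk_one_le_rk_tensor [CharP F 2] (m : ℕ) (hm : Even m) (W : NilMod F) :
    W.rk 1 ≤ ((cyclic F (m + 1)).tensor W).rk (m + 1) := by
  obtain ⟨π, hπ⟩ := exists_cyclic_functional (F := F) m
  let ψ : ((cyclic F (m + 1)).tensor W).carrier →ₗ[F] W.carrier :=
    (TensorProduct.lid F W.carrier).toLinearMap ∘ₗ π.rTensor W.carrier
  have hψ : ∀ x w, ψ (tmul _ _ x w) = π x • w := fun x w => rfl
  have h : W.T = ψ ∘ₗ (((cyclic F (m + 1)).tensor W).T ^ (m + 1)) ∘ₗ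
      tmul _ W (cyclicOne F (m + 1)) := by
    refine LinearMap.ext fun w => ?_
    rw [LinearMap.comp_apply, LinearMap.comp_apply, tensor_T_pow_tmul, map_sum,
      Finset.sum_eq_single m]
    · rw [map_nsmul, hψ, hπ, if_pos rfl, one_smul, Nat.choose_succ_self_right,
        ← Nat.cast_smul_eq_nsmul F, Nat.cast_succ, Nat.add_sub_cancel_left, pow_one,
        (CharP.cast_eq_zero_iff F 2 m).2 hm.two_dvd, zero_add, one_smul]
    · intro k _ hkm
      rw [map_nsmul, hψ, hπ, if_neg hkm, zero_smul,
        smul_zero]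
    · intro hk
      simp at hk
  rw [rk, pow_one, h, rk, LinearMap.range_comp, LinearMap.range_comp]
  refine (Submodule.finrank_map_le _ _).trans (Submodule.finrank_mono ?_)
  exact LinearMap.map_le_range

end NilMod

/-! ### Products of the μ_i in characteristic 2 -/

namespace Gamma

variable {F : Type u} [Field F]

/-- The 2^n jumps of the tensor product are each at most dim W and add up to 2^n dim W, so all are
equal to dim W. -/
theorem cls_cyclic_mul_cls [CharP F 2] {n : ℕ} {W : NilMod F} (hW : W.T ^ 2 ^ n = 0) :
    cls (NilMod.cyclic F (2 ^ n)) * cls W = W.dim * cls (NilMod.cyclic F (2 ^ n)) := by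
  have h0 := NilMod.tensor_T_pow_two_pow (NilMod.cyclic_T_pow (F := F) (2 ^ n)) hW
  have h1 : ∀ k ∈ Finset.range (2 ^ n), ((NilMod.cyclic F (2 ^ n)).tensor W).jump k = W.dim := by
    refine (Finset.sum_eq_sum_iff_of_le
      fun k _ => NilMod.jump_cyclic_tensor_le (2 ^ n) W k).1 ?_
    rw [NilMod.sum_jump_of_pow_eq_zero h0, NilMod.dim_tensor, NilMod.dim_cyclic]
    simp
  rw [← cls_tensor, cls_eq_sum_jump h0, ← sum_mu, Finset.mul_sum]
  refine Finset.sum_congr rfl fun k hk => ?_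
  rw [h1 k hk, zsmul_eq_mul, Int.cast_natCast]

/-- A zero at k < s would leave at most k ones, and a one at k ≥ s would force at least k + 1 of
them. -/
theorem _root_.Antitone.eq_ite_of_sum_eq {b : ℕ → ℤ} (hb : Antitone b) {q s : ℕ}
    (h0 : ∀ k < q, 0 ≤ b k) (h1 : ∀ k < q, b k ≤ 1) (hs : ∑ k ∈ Finset.range q, b k = s)
    {k : ℕ} (hk : k < q) : b k = if k < s then 1 else 0 := by
  have h0k := h0 k hk
  have h1k := h1 k hk
  split_ifs with hks
  · by_contra hne
    have h2 : ∑ i ∈ Finset.range q, b i ≤ ∑ i ∈ Finset.range q, if i < k then 1 else 0 := by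
      refine Finset.sum_le_sum fun i hi => ?_
      split_ifs with hik
      · exact h1 i (Finset.mem_range.1 hi)
      · exact (hb (not_lt.1 hik)).trans (by omega)
    rw [hs, Finset.sum_ite, Finset.sum_const_zero, add_zero, Finset.sum_const, nsmul_eq_mul,
      mul_one] at h2
    have h3 : (Finset.range q).filter (· < k) ⊆ Finset.range k := fun i hi => by
      simpa using (Finset.mem_filter.1 hi).2
    have h4 := Finset.card_le_card h3
    rw [Finset.card_range] at h4
    omega
  · by_contra hne
    have h2 : ∑ i ∈ Finset.range (k + 1), (1 : ℤ) ≤ ∑ i ∈ Finset.range q, b i := by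
      refine (Finset.sum_le_sum fun i hi => ?_).trans (Finset.sum_le_sum_of_subset_of_nonneg
        (Finset.range_subset_range.2 hk) fun i hi _ => h0 i (Finset.mem_range.1 hi))
      have := hb (Nat.lt_succ_iff.1 (Finset.mem_range.1 hi))
      omega
    simp at h2
    omega

/-- With q = 2^n, the jumps below q are at most j, and the last of them, the rank of T^{q-1}, is at
least j - 1 by `rk_one_le_rk_tensor` with m = q - 2. Their sum (q-1)j = q(j-1) + (q-j) then says
that exactly the first q - j are equal to j. -/
theorem cls_cyclic_pred_mul [CharP F 2] {n j : ℕ} (hn : n ≠ 0) (hj : 1 ≤ j) (hjq : j ≤ 2 ^ n) :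
    cls (NilMod.cyclic F (2 ^ n - 1)) * cls (NilMod.cyclic F j) =
      (j - 1) * cls (NilMod.cyclic F (2 ^ n)) + cls (NilMod.cyclic F (2 ^ n - j)) := by
  obtain ⟨m, hm⟩ : ∃ m, 2 ^ n = m + 2 :=
    ⟨2 ^ n - 2, by have := Nat.pow_le_pow_right (n := 2) two_pos (Nat.one_le_iff_ne_zero.2 hn); omega⟩
  have hme : Even m := by
    have h2 : Even (2 ^ n) := (Nat.even_pow.2 ⟨even_two, hn⟩)
    rw [hm] at h2
    simpa [Nat.even_add] using h2
  set V := (NilMod.cyclic F (2 ^ n - 1)).tensor (NilMod.cyclic F j) with hV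
  have h0 : V.T ^ 2 ^ n = 0 := NilMod.tensor_T_pow_two_pow
    (pow_eq_zero_of_le (Nat.sub_le _ _) (NilMod.cyclic_T_pow _))
    (pow_eq_zero_of_le hjq (NilMod.cyclic_T_pow _))
  have hle : ∀ k, V.jump k ≤ j := fun k =>
    (NilMod.jump_cyclic_tensor_le _ _ k).trans (by rw [NilMod.dim_cyclic])
  have hge : ∀ k < 2 ^ n, (j : ℤ) - 1 ≤ V.jump k := fun k hk => by
    refine le_trans ?_ (V.jump_antitone (Nat.le_sub_one_of_lt hk))
    have h1 := NilMod.rk_one_le_rk_tensor m hme (NilMod.cyclic F j)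
    have h2 := NilMod.jump_cyclic (F := F) j 0
    rw [NilMod.jump, NilMod.rk_zero, NilMod.dim_cyclic, if_pos (by omega)] at h2
    have h3 : 2 ^ n - 1 = m + 1 := by omega
    rw [NilMod.jump, Nat.sub_add_cancel Nat.one_le_two_pow, NilMod.rk_eq_zero h0, hV, h3]
    simp only [zero_add] at h2
    omega
  have hsum : ∑ k ∈ Finset.range (2 ^ n), (V.jump k - (j - 1)) = (2 ^ n - j : ℕ) := by
    rw [Finset.sum_sub_distrib, NilMod.sum_jump_of_pow_eq_zero h0, NilMod.dim_tensor,
      NilMod.dim_cyclic, NilMod.dim_cyclic]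
    simp only [Finset.sum_const, Finset.card_range, nsmul_eq_mul]
    push_cast [Nat.cast_sub hjq, Nat.cast_sub Nat.one_le_two_pow]
    ring
  have hb : Antitone fun k => V.jump k - ((j : ℤ) - 1) := fun a b hab =>
    sub_le_sub_right (V.jump_antitone hab) _
  -- The sum for δ_{q-j} is extended by zeros to all k < q, so that the two sides can be compared
  -- term by term.
  rw [← cls_tensor, cls_eq_sum_jump h0, ← sum_mu, ← sum_mu (2 ^ n - j), Finset.mul_sum,
    Finset.sum_subset (Finset.range_subset_range.2 (Nat.sub_le (2 ^ n) j)) (f := fun k =>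
      if k < 2 ^ n - j then mu F k else 0) (fun k _ hk => if_neg (by simpa using hk)) |>.symm.trans
        (Finset.sum_congr rfl fun k hk => if_pos (Finset.mem_range.1 hk)) |>.symm,
    ← Finset.sum_add_distrib]
  refine Finset.sum_congr rfl fun k hk => ?_
  have hk' := Finset.mem_range.1 hk
  have h5 := hb.eq_ite_of_sum_eq (fun k hk => sub_nonneg.2 (hge k hk))
    (fun k _ => by have := hle k; omega) hsum hk'
  rw [eq_add_of_sub_eq' h5]
  split_ifs <;> simp
  ring

theorem mu_pred_mul_cls [CharP F 2] {n j : ℕ} (hj : j ≤ 2 ^ n) :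
    mu F (2 ^ n - 1) * cls (NilMod.cyclic F j) =
      cls (NilMod.cyclic F (2 ^ n)) - cls (NilMod.cyclic F (2 ^ n - j)) := by
  rcases Nat.eq_zero_or_pos j with rfl | hj0
  · rw [cls_cyclic_zero, mul_zero, Nat.sub_zero, sub_self]
  -- For n = 0 the number 2^n - 2 used in `cls_cyclic_pred_mul` makes no sense, and the claim is
  -- checked directly.
  rcases Nat.eq_zero_or_pos n with rfl | hn
  · obtain rfl : j = 1 := by simp at hj; omega
    simp [mu_zero, cls_cyclic_zero]
  · have h := cls_cyclic_mul_cls (F := F) (n := n) (W := NilMod.cyclic F j)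
      (pow_eq_zero_of_le hj (NilMod.cyclic_T_pow _))
    rw [NilMod.dim_cyclic] at h
    rw [mu, Nat.sub_add_cancel Nat.one_le_two_pow, sub_mul, h,
      cls_cyclic_pred_mul hn.ne' hj0 hj]
    ring

theorem mu_pred_mul_mu [CharP F 2] {n j : ℕ} (hj : j < 2 ^ n) :
    mu F (2 ^ n - 1) * mu F j = mu F (2 ^ n - 1 - j) := by
  have h : 2 ^ n - 1 - j + 1 = 2 ^ n - j := by omega
  rw [mu, mu, mul_sub, ← mu, mu_pred_mul_cls hj, mu_pred_mul_cls hj.le, mu, h]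
  have h : 2 ^ n - 1 - j = 2 ^ n - (j + 1) := by omega
  rw [h]
  ring

/-- With q = 2^n, the reflections i ↦ q-1-i and then i ↦ 2q-1-i compose to i ↦ q+i. The case i = 0
identifies the composite multiplier μ_{2q-1} μ_{q-1} as μ_q. -/
theorem mu_two_pow_mul_mu [CharP F 2] {n i : ℕ} (hi : i < 2 ^ n) :
    mu F (2 ^ n) * mu F i = mu F (2 ^ n + i) := by
  have key : ∀ i < 2 ^ n, mu F (2 ^ (n + 1) - 1) * (mu F (2 ^ n - 1) * mu F i) =
      mu F (2 ^ n + i) := fun i hi => by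
    rw [mu_pred_mul_mu hi, mu_pred_mul_mu (by rw [pow_succ]; omega)]
    congr 1
    rw [pow_succ]
    omega
  have h0 := key 0 (by positivity)
  rw [mu_zero, mul_one, add_zero] at h0
  rw [← h0, mul_assoc, key i hi]

/-- Both μ_{q-1} and μ_{2q-1} = μ_q μ_{q-1} square to 1. -/
theorem mu_two_pow_mul_self [CharP F 2] (n : ℕ) : mu F (2 ^ n) * mu F (2 ^ n) = 1 := by
  have hp : ∀ n, mu F (2 ^ n - 1) * mu F (2 ^ n - 1) = 1 := fun n => by
    rw [mu_pred_mul_mu (Nat.sub_lt (by positivity) one_pos), Nat.sub_self, mu_zero]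
  have h := mu_two_pow_mul_mu (F := F) (n := n) (i := 2 ^ n - 1)
    (Nat.sub_lt (by positivity) one_pos)
  have h2 : 2 ^ n + (2 ^ n - 1) = 2 ^ (n + 1) - 1 := by
    rw [pow_succ]
    have := Nat.one_le_two_pow (n := n)
    omega
  have h3 := hp (n + 1)
  rwa [← h2, ← h, mul_mul_mul_comm, hp, mul_one] at h3

end Gamma

/-! ### The product `#` -/

namespace DyadicI

theorem ext {s t : DyadicI} (h : s.1 = t.1) : s = t := Subtype.ext h

theorem half_one_eq : one.half = zero.halfSucc :=
  ext (by simp [half, halfSucc, one, zero])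

theorem halfSucc_one : one.halfSucc = one :=
  ext (by norm_num [halfSucc, one])

theorem half_zero : zero.half = zero :=
  ext (by simp [half, zero])

theorem double_half (t : DyadicI) (h : t.half.1 ≤ 1 / 2) : t.half.double h = t :=
  ext (by simp only [double, half]; ring)

theorem doublePred_halfSucc (t : DyadicI) (h : 1 / 2 ≤ t.halfSucc.1) :
    t.halfSucc.doublePred h = t :=
  ext (by simp only [doublePred, halfSucc]; ring)

theorem half_node (n i : ℕ) (hi : i ≤ 2 ^ n) (hi' : i ≤ 2 ^ (n + 1)) :
    (node n i hi).half = node (n + 1) i hi' :=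
  ext (by simp only [half, node, pow_succ]; field_simp)

theorem halfSucc_node (n i : ℕ) (hi : i ≤ 2 ^ n) (hi' : 2 ^ n + i ≤ 2 ^ (n + 1)) :
    (node n i hi).halfSucc = node (n + 1) (2 ^ n + i) hi' :=
  ext (by simp only [halfSucc, node, pow_succ]; push_cast; field_simp)

theorem exists_eq_node (t : DyadicI) : ∃ (n i : ℕ) (hi : i ≤ 2 ^ n), t = node n i hi := by
  obtain ⟨q, h0, h1, n, k, h⟩ := t
  have hk0 : 0 ≤ k := by
    rw [h] at h0
    have := (le_div_iff₀ (by positivity)).1 h0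
    rw [zero_mul] at this
    exact_mod_cast this
  lift k to ℕ using hk0
  have hk1 : k ≤ 2 ^ n := by
    rw [h, div_le_one (by positivity)] at h1
    exact_mod_cast h1
  exact ⟨n, k, hk1, ext (by simpa [node] using h)⟩

end DyadicI

namespace DyadicFun

open DyadicI

theorem sharp_zero (α β : DyadicFun) : sharp α β zero = 0 := by
  rw [sharp]
  exact dif_pos rfl

theorem sharp_one (α β : DyadicFun) :
    sharp α β one = (α one - α zero) * (β one - β zero) := by
  rw [sharp]
  exact (dif_neg one_ne_zero).trans (dif_pos rfl)

theorem sharp_half (α β : DyadicFun) (t : DyadicI) :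
    sharp α β t.half = sharp (T0 α) (T0 β) t + sharp (T1 α) (T1 β) t := by
  by_cases h0 : t.1 = 0
  · obtain rfl : t = zero := ext h0
    simp only [half_zero, sharp_zero, add_zero]
  · have h1 : t.half.1 ≤ 1 / 2 := by
      have := t.2.2.1
      simp only [half]
      linarith
    rw [sharp, dif_neg (by simpa [half] using h0), dif_neg (by linarith), dif_pos h1]
    simp only [double_half]

/-- At t = 0 and t = 1 the recursion uses other clauses. They agree with this one: at t = 1 because
(a₀+a₁)(b₀+b₁) is the sum of the four products of increments over the halves. -/
theorem sharp_halfSucc (α β : DyadicFun) (t : DyadicI) :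
    sharp α β t.halfSucc = sharp (T0 α) (T0 β) one + sharp (T1 α) (T1 β) one
      + sharp (T0 α) (T1 β) t + sharp (T1 α) (T0 β) t := by
  have ht0 := t.2.1
  by_cases h0 : t.1 = 0
  · obtain rfl : t = zero := ext h0
    rw [← half_one_eq, sharp_half, sharp_zero, sharp_zero, add_zero, add_zero]
  by_cases h1 : t.1 = 1
  · obtain rfl : t = one := ext h1
    simp only [halfSucc_one, sharp_one, T0, T1, half_zero, ← half_one_eq]
    ring
  · have h2 : ¬ t.halfSucc.1 ≤ 1 / 2 := by
      have : 0 < t.1 := lt_of_le_of_ne ht0 (Ne.symm h0)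
      simp only [halfSucc]
      linarith
    rw [sharp, dif_neg (by simp only [halfSucc]; linarith),
      dif_neg (by simp only [halfSucc]; intro h; exact h1 (by linarith)), dif_neg h2]
    simp only [doublePred_halfSucc]

theorem T0_sharp (α β : DyadicFun) :
    T0 (sharp α β) = sharp (T0 α) (T0 β) + sharp (T1 α) (T1 β) :=
  funext fun t => sharp_half α β t

theorem T1_sharp (α β : DyadicFun) :
    T1 (sharp α β) = sharp (T0 α) (T1 β) + sharp (T1 α) (T0 β) +
      Function.const _ (sharp (T0 α) (T0 β) one + sharp (T1 α) (T1 β) one) :=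
  funext fun t => (sharp_halfSucc α β t).trans (by simp only [Pi.add_apply, Function.const]; ring)

end DyadicFun

/-! ### Multiplicativity and joint injectivity of the L_n -/

section scriptL

open DyadicI DyadicFun

variable {F : Type u} [Field F]

/-- The difference `α ((i + 1) / 2 ^ n) - α (i / 2 ^ n)`. -/
def DyadicFun.diff (n : ℕ) (α : DyadicFun) (i : Fin (2 ^ n)) : ℚ :=
  α (node n (i + 1) i.2) - α (node n i i.2.le)

theorem scriptL_eq (n : ℕ) (α : DyadicFun) :
    scriptL F n α = ∑ i : Fin (2 ^ n), Gamma.mu F i ⊗ₜ[ℤ] α.diff n i := by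
  refine Finset.sum_congr rfl fun i _ => ?_
  rw [Gamma.lam_eq]
  rcases Nat.even_or_odd (i : ℕ) with h | h
  · rw [h.neg_one_pow, h.neg_one_pow, one_mul, mul_one]; rfl
  · rw [h.neg_one_pow, h.neg_one_pow, neg_one_mul, mul_neg_one, TensorProduct.neg_tmul,
      TensorProduct.tmul_neg, neg_neg]; rfl

theorem scriptL_add (n : ℕ) (α β : DyadicFun) :
    scriptL F n (α + β) = scriptL F n α + scriptL F n β := by
  simp only [scriptL_eq, ← Finset.sum_add_distrib, ← TensorProduct.tmul_add, DyadicFun.diff,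
    Pi.add_apply, add_sub_add_comm]

theorem scriptL_const (n : ℕ) (c : ℚ) : scriptL F n (Function.const _ c) = 0 := by
  simp [scriptL_eq, DyadicFun.diff]

theorem scriptL_zero (α : DyadicFun) :
    scriptL F 0 α = (1 : Gamma F) ⊗ₜ[ℤ] (α one - α zero) := by
  have h0 : node 0 0 (Nat.zero_le _) = zero := DyadicI.ext (by simp [node, zero])
  have h1 : node 0 1 le_rfl = one := DyadicI.ext (by simp [node, one])
  rw [scriptL_eq, ← Gamma.mu_zero, ← h0, ← h1]
  exact Fin.sum_univ_one _

/-- The indices below 2^{n+1} are split by their top binary digit, and μ_{2^n+i} = μ_{2^n} μ_i. -/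
theorem scriptL_succ [CharP F 2] (n : ℕ) (α : DyadicFun) :
    scriptL F (n + 1) α = scriptL F n (T0 α) +
      (Gamma.mu F (2 ^ n) ⊗ₜ[ℤ] (1 : ℚ)) * scriptL F n (T1 α) := by
  have e : 2 ^ n + 2 ^ n = 2 ^ (n + 1) := by ring
  rw [scriptL_eq, scriptL_eq, scriptL_eq, ← (finCongr e).sum_comp, Fin.sum_univ_add,
    Finset.mul_sum]
  congr 1
  · refine Finset.sum_congr rfl fun i _ => ?_
    have hi := i.2
    simp only [DyadicFun.diff, T0, finCongr_apply, Fin.val_cast, Fin.val_castAdd]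
    rw [half_node _ _ _ (by omega), half_node _ _ _ (by omega)]
  · refine Finset.sum_congr rfl fun i _ => ?_
    have hi := i.2
    simp only [DyadicFun.diff, T1, finCongr_apply, Fin.val_cast, Fin.val_natAdd]
    rw [halfSucc_node _ _ _ (by omega), halfSucc_node _ _ _ (by omega),
      Algebra.TensorProduct.tmul_mul_tmul, one_mul, Gamma.mu_two_pow_mul_mu hi]
    rfl

theorem scriptL_sharp [CharP F 2] (n : ℕ) (α β : DyadicFun) :
    scriptL F n (sharp α β) = scriptL F n α * scriptL F n β := by
  induction n generalizing α β with
  | zero =>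
    rw [scriptL_zero, scriptL_zero, scriptL_zero, Algebra.TensorProduct.tmul_mul_tmul, one_mul,
      sharp_one, sharp_zero, sub_zero]
  | succ n ih =>
    have hm : (Gamma.mu F (2 ^ n) ⊗ₜ[ℤ] (1 : ℚ)) * (Gamma.mu F (2 ^ n) ⊗ₜ[ℤ] (1 : ℚ)) = 1 := by
      rw [Algebra.TensorProduct.tmul_mul_tmul, Gamma.mu_two_pow_mul_self, one_mul]
      rfl
    rw [scriptL_succ, scriptL_succ n α, scriptL_succ n β, T0_sharp, T1_sharp]
    simp only [scriptL_add, scriptL_const, ih, add_zero]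
    -- (a₀ + μ a₁)(b₀ + μ b₁) = (a₀b₀ + a₁b₁) + μ(a₀b₁ + a₁b₀), since μ² = 1; the constant in
    -- `T1_sharp` has already disappeared.
    linear_combination (-(scriptL F n (T1 α) * scriptL F n (T1 β))) * hm

/-- The functional `[V] ⊗ c ↦ c dim (T ^ k V / T ^ (k + 1) V)` on `Γ_ℚ`. -/
def GammaQ.jump (F : Type u) [Field F] (k : ℕ) : GammaQ F →ₗ[ℤ] ℚ :=
  TensorProduct.lift
    ((LinearMap.lsmul ℤ ℚ).comp (Gamma.jump F k).toIntLinearMap)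

theorem GammaQ.jump_tmul (k : ℕ) (x : Gamma F) (c : ℚ) :
    GammaQ.jump F k (x ⊗ₜ c) = Gamma.jump F k x • c := rfl

theorem GammaQ.jump_scriptL (n : ℕ) (α : DyadicFun) (k : Fin (2 ^ n)) :
    GammaQ.jump F k (scriptL F n α) = α.diff n k := by
  rw [scriptL_eq, map_sum, Finset.sum_eq_single k]
  · rw [GammaQ.jump_tmul, Gamma.jump_mu, if_pos rfl, one_smul]
  · intro i _ hi
    rw [GammaQ.jump_tmul, Gamma.jump_mu, if_neg (fun h => hi (Fin.ext h.symm)), zero_smul]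
  · simp

variable (F) in
theorem eq_of_scriptL_eq {α β : DyadicFun} (h0 : α zero = β zero)
    (h : ∀ n, scriptL F n α = scriptL F n β) : α = β := by
  funext t
  obtain ⟨n, i, hi, rfl⟩ := t.exists_eq_node
  induction i with
  | zero =>
    have hz : node n 0 hi = zero := DyadicI.ext (by simp [node, zero])
    rw [hz, h0]
  | succ i ih =>
    have h1 := congrArg (GammaQ.jump F i) (h n)
    have h2 := GammaQ.jump_scriptL (F := F) n α ⟨i, hi⟩
    have h3 := GammaQ.jump_scriptL (F := F) n β ⟨i, hi⟩
    simp only at h2 h3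
    rw [h2, h3, DyadicFun.diff, DyadicFun.diff, ih] at h1
    exact sub_left_injective h1

end scriptL

/-! ### The truncated algebra `F[[u]] / (u ^ q)` -/

/-- Transvections diagonalise M; their determinant 1 survives φ and the Kronecker product. On a
diagonal matrix the rank counts nonzero entries, which φ preserves. -/
theorem Matrix.rank_map_kronecker_one {K L m e : Type*} [Field K] [Field L] [Fintype m]
    [DecidableEq m] [Fintype e] [DecidableEq e] (φ : K →+* L) (M : Matrix m m K) :
    (kroneckerMap (· * ·) (M.map φ) (1 : Matrix e e L)).rank = M.rank * Fintype.card e := by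
  classical
  obtain ⟨P, Q, D, h⟩ := Matrix.Pivot.exists_list_transvec_mul_diagonal_mul_list_transvec M
  have hP := TransvectionStruct.det_toMatrix_prod P
  have hQ := TransvectionStruct.det_toMatrix_prod Q
  set A := (P.map TransvectionStruct.toMatrix).prod
  set B := (Q.map TransvectionStruct.toMatrix).prod
  have hdet : ∀ C : Matrix m m K, C.det = 1 →
      IsUnit (kroneckerMap (· * ·) (C.map φ) (1 : Matrix e e L)).det := fun C hC => by
    have h1 : (C.map φ).det = 1 := by
      rw [← RingHom.mapMatrix_apply, ← RingHom.map_det, hC, map_one]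
    rw [Matrix.det_kronecker, h1]
    simp
  have hmul : kroneckerMap (· * ·) ((A * diagonal D * B).map φ) (1 : Matrix e e L) =
      kroneckerMap (· * ·) (A.map φ) (1 : Matrix e e L) *
        kroneckerMap (· * ·) ((diagonal D).map φ) (1 : Matrix e e L) *
        kroneckerMap (· * ·) (B.map φ) (1 : Matrix e e L) := by
    rw [← Matrix.mul_kronecker_mul, ← Matrix.mul_kronecker_mul, one_mul, one_mul, Matrix.map_mul,
      Matrix.map_mul]
  have hdiag : kroneckerMap (· * ·) ((diagonal D).map φ) (1 : Matrix e e L) =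
      diagonal fun x : m × e => φ (D x.1) := by
    rw [diagonal_map (map_zero φ), ← diagonal_one, diagonal_kronecker_diagonal]
    simp
  rw [h, hmul, rank_mul_eq_left_of_isUnit_det _ _ (hdet B hQ),
    rank_mul_eq_right_of_isUnit_det _ _ (hdet A hP), hdiag, rank_diagonal,
    rank_mul_eq_left_of_isUnit_det _ _ (by rw [hQ]; exact isUnit_one),
    rank_mul_eq_right_of_isUnit_det _ _ (by rw [hP]; exact isUnit_one), rank_diagonal,
    ← Fintype.card_prod]
  refine Fintype.card_congr ⟨fun x => (⟨x.1.1, fun h => x.2 (by simp [h])⟩, x.1.2),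
    fun x => ⟨(x.1.1, x.2), by simpa using x.1.2⟩, fun _ => rfl, fun _ => rfl⟩

namespace MvPowerSeries

variable {σ : Type} {F : Type u} [Field F]

/-- The ideal `(u ^ q)`. -/
def powIdeal (σ : Type) (F : Type u) [Field F] (q : ℕ) : Ideal (MvPowerSeries σ F) :=
  Ideal.span (Set.range fun j : σ => (X j : MvPowerSeries σ F) ^ q)

theorem coeff_eq_zero_of_mem_powIdeal {q : ℕ} {f : MvPowerSeries σ F} (hf : f ∈ powIdeal σ F q)
    {a : σ →₀ ℕ} (ha : ∀ j, a j < q) : coeff a f = 0 := by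
  classical
  induction hf using Submodule.span_induction generalizing a with
  | mem x hx =>
    obtain ⟨j, rfl⟩ := hx
    refine (coeff_X_pow _ _ _).trans (if_neg fun h => (ha j).ne ?_)
    rw [h, Finsupp.single_eq_same]
  | zero => exact map_zero _
  | add x y _ _ hx hy => rw [map_add, hx ha, hy ha, add_zero]
  | smul r x _ hx =>
    rw [smul_eq_mul, coeff_mul]
    refine Finset.sum_eq_zero fun p hp => ?_
    rw [hx, mul_zero]
    intro j
    have h := DFunLike.congr_fun (Finset.HasAntidiagonal.mem_antidiagonal.1 hp) j
    rw [Finsupp.add_apply] at h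
    have := ha j
    omega

theorem mem_powIdeal_iff [Fintype σ] {q : ℕ} {f : MvPowerSeries σ F} :
    f ∈ powIdeal σ F q ↔ ∀ a : σ →₀ ℕ, (∀ j, a j < q) → coeff a f = 0 := by
  classical
  refine ⟨fun hf a ha => coeff_eq_zero_of_mem_powIdeal hf ha, fun hf => ?_⟩
  -- Each monomial outside the box is assigned to one variable whose q-th power divides it; grouping
  -- the terms accordingly writes f as ∑ X_j^q g_j.
  let J : (σ →₀ ℕ) → Option σ := fun a => if h : ∃ j, q ≤ a j then some h.choose else none
  have hJ : ∀ a j, J a = some j → q ≤ a j := fun a j h => by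
    by_cases h' : ∃ j, q ≤ a j
    · simp only [J, dif_pos h', Option.some.injEq] at h
      exact h ▸ h'.choose_spec
    · simp [J, dif_neg h'] at h
  have hJn : ∀ a, J a = none → coeff a f = 0 := fun a h => hf a fun j => by
    by_contra hj
    have h' : ∃ j, q ≤ a j := ⟨j, not_lt.1 hj⟩
    simp [J, dif_pos h'] at h
  let g : σ → MvPowerSeries σ F := fun j b =>
    if J (b + Finsupp.single j q) = some j then coeff (b + Finsupp.single j q) f else 0
  have hg : ∀ j b, coeff b (g j) = if J (b + Finsupp.single j q) = some j then
      coeff (b + Finsupp.single j q) f else 0 := fun j b => rfl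
  have hfg : f = ∑ j, X j ^ q * g j := by
    ext a
    rw [map_sum]
    have hterm : ∀ j, coeff a (X j ^ q * g j) = if J a = some j then coeff a f else 0 := fun j => by
      rw [X_pow_eq, coeff_monomial_mul, one_mul, hg]
      by_cases hle : Finsupp.single j q ≤ a
      · rw [if_pos hle, tsub_add_cancel_of_le hle]
      · rw [if_neg hle, if_neg fun h => hle (Finsupp.single_le_iff.2 (hJ a j h))]
    simp only [hterm]
    rcases hJa : J a with _ | j
    · simp [hJn a hJa]
    · simp
  rw [hfg]
  exact sum_mem fun j _ => Ideal.mul_mem_right _ _ (Ideal.subset_span ⟨j, rfl⟩)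

theorem coeff_two_smul_sq [CharP F 2] (f : MvPowerSeries σ F) (a : σ →₀ ℕ) :
    coeff (2 • a) (f ^ 2) = frobenius F 2 (coeff a f) := by
  rw [← map_frobenius_expand 2 two_ne_zero, coeff_map, coeff_expand_smul]

theorem coeff_sq_of_odd [CharP F 2] (f : MvPowerSeries σ F) {a : σ →₀ ℕ} {j : σ}
    (h : ¬ 2 ∣ a j) : coeff a (f ^ 2) = 0 := by
  rw [← map_frobenius_expand 2 two_ne_zero, coeff_map,
    coeff_expand_of_not_dvd 2 two_ne_zero f h, map_zero]

variable [Fintype σ]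

/-- The exponent with the given coordinates. -/
def expo {q : ℕ} (a : σ → Fin q) : σ →₀ ℕ := Finsupp.equivFunOnFinite.symm fun j => (a j : ℕ)

theorem expo_apply {q : ℕ} (a : σ → Fin q) (j : σ) : expo a j = a j := rfl

theorem expo_injective {q : ℕ} : Function.Injective (expo : (σ → Fin q) → σ →₀ ℕ) :=
  fun _ _ h => funext fun j => Fin.ext (DFunLike.congr_fun h j)

theorem exists_expo_eq {q : ℕ} {a : σ →₀ ℕ} (ha : ∀ j, a j < q) :
    ∃ b : σ → Fin q, expo b = a :=
  ⟨fun j => ⟨a j, ha j⟩, Finsupp.ext fun _ => rfl⟩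

/-- The coefficients at the exponents below `q`. -/
def lowCoeff (σ : Type) (F : Type u) [Field F] [Fintype σ] (q : ℕ) :
    MvPowerSeries σ F →ₗ[F] ((σ → Fin q) → F) :=
  LinearMap.pi fun a => coeff (expo a)

theorem lowCoeff_apply {q : ℕ} (f : MvPowerSeries σ F) (a : σ → Fin q) :
    lowCoeff σ F q f a = coeff (expo a) f := rfl

theorem ker_lowCoeff (q : ℕ) :
    (powIdeal σ F q).restrictScalars F = LinearMap.ker (lowCoeff σ F q) := by
  ext f
  rw [Submodule.restrictScalars_mem, mem_powIdeal_iff, LinearMap.mem_ker]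
  refine ⟨fun h => funext fun a => h _ fun j => (a j).2, fun h a ha => ?_⟩
  obtain ⟨b, rfl⟩ := exists_expo_eq ha
  exact congrFun h b

theorem lowCoeff_monomial {q : ℕ} [DecidableEq (σ → Fin q)] (a : σ → Fin q) :
    lowCoeff σ F q (monomial (expo a) 1) = Pi.single a 1 := by
  classical
  funext b
  rw [lowCoeff_apply, coeff_monomial, Pi.single_apply]
  simp only [expo_injective.eq_iff]

theorem lowCoeff_surjective (q : ℕ) : Function.Surjective (lowCoeff σ F q) := by
  classical
  intro c
  refine ⟨∑ a, c a • monomial (expo a) 1, ?_⟩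
  rw [map_sum]
  simp only [map_smul, lowCoeff_monomial]
  ext b
  simp [Finset.sum_apply, Pi.single_apply]

/-- `F[[u]] / (u ^ q)`. -/
abbrev Trunc (σ : Type) (F : Type u) [Field F] (q : ℕ) : Type u :=
  MvPowerSeries σ F ⧸ powIdeal σ F q

/-- The coordinates on `F[[u]] / (u ^ q)` given by the monomials. -/
def truncEquiv (σ : Type) (F : Type u) [Field F] [Fintype σ] (q : ℕ) :
    Trunc σ F q ≃ₗ[F] ((σ → Fin q) → F) :=
  (Submodule.Quotient.restrictScalarsEquiv F (powIdeal σ F q)).symm ≪≫ₗ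
    Submodule.quotEquivOfEq _ _ (ker_lowCoeff q) ≪≫ₗ
    (lowCoeff σ F q).quotKerEquivOfSurjective (lowCoeff_surjective q)

theorem truncEquiv_mk (q : ℕ) (f : MvPowerSeries σ F) :
    truncEquiv σ F q (Ideal.Quotient.mk _ f) = lowCoeff σ F q f := rfl

instance finite_trunc (q : ℕ) : Module.Finite F (Trunc σ F q) :=
  Module.Finite.equiv (truncEquiv σ F q).symm

theorem finrank_trunc (q : ℕ) : Module.finrank F (Trunc σ F q) = q ^ Fintype.card σ := by
  classical
  rw [(truncEquiv σ F q).finrank_eq, Module.finrank_fintype_fun_eq_card]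
  simp

/-- Multiplication by `f` on `F[[u]] / (u ^ q)`. -/
def truncMul (q : ℕ) (f : MvPowerSeries σ F) : Module.End F (Trunc σ F q) :=
  LinearMap.mulLeft F (Ideal.Quotient.mk (powIdeal σ F q) f)

/-- The quotient by (u^q, f^i) is the cokernel of f^i on F[[u]]/(u^q). -/
theorem frobColength_add_finrank_range (f : MvPowerSeries σ F) (q i : ℕ) :
    frobColength f q i + Module.finrank F (LinearMap.range (truncMul q (f ^ i))) =
      q ^ Fintype.card σ := by
  rw [← finrank_trunc (F := F), ← Submodule.finrank_quotient_add_finrank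
    (LinearMap.range (truncMul q (f ^ i)))]
  congr 1
  have hI : Ideal.span (Set.range (fun j : σ => (X j : MvPowerSeries σ F) ^ q) ∪ {f ^ i}) =
      powIdeal σ F q ⊔ Ideal.span {f ^ i} := Ideal.span_union _ _
  rw [frobColength, hI, ← (DoubleQuot.quotQuotEquivQuotSupₐ F (powIdeal σ F q)
    (Ideal.span {f ^ i})).toLinearEquiv.finrank_eq, Ideal.map_span, Set.image_singleton]
  have hr : (Ideal.span {Ideal.Quotient.mkₐ F (powIdeal σ F q) (f ^ i)}).restrictScalars F =
      LinearMap.range (truncMul q (f ^ i)) := by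
    ext x
    rw [Submodule.restrictScalars_mem, Ideal.mem_span_singleton]
    exact ⟨fun ⟨y, hy⟩ => ⟨y, hy.symm⟩, fun ⟨y, hy⟩ => ⟨y, hy.symm⟩⟩
  rw [← hr]
  exact (Submodule.Quotient.restrictScalarsEquiv F _).symm.finrank_eq

/-- The matrix of the multiplication by `f` on `F[[u]] / (u ^ q)`. -/
def mulMatrix (q : ℕ) (f : MvPowerSeries σ F) : Matrix (σ → Fin q) (σ → Fin q) F :=
  Matrix.of fun a b => if expo b ≤ expo a then coeff (expo a - expo b) f else 0

theorem rank_mulMatrix [DecidableEq σ] (q : ℕ) (f : MvPowerSeries σ F) :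
    (mulMatrix q f).rank = Module.finrank F (LinearMap.range (truncMul q f)) := by
  classical
  let b := Module.Basis.ofEquivFun (truncEquiv σ F q)
  rw [Matrix.rank_eq_finrank_range_toLin _ b b]
  suffices h : Matrix.toLin b b (mulMatrix q f) = truncMul q f by rw [h]
  rw [← LinearEquiv.eq_symm_apply, Matrix.toLin_symm]
  ext i j
  rw [LinearMap.toMatrix_apply]
  have hb : b j = Ideal.Quotient.mk _ (monomial (expo j) 1) := by
    rw [Module.Basis.coe_ofEquivFun, LinearEquiv.symm_apply_eq, truncEquiv_mk, lowCoeff_monomial]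
  rw [hb, Module.Basis.ofEquivFun_repr_apply]
  have h : truncMul q f (Ideal.Quotient.mk _ (monomial (expo j) 1)) =
    Ideal.Quotient.mk _ (f * monomial (expo j) 1) := rfl
  rw [h, truncEquiv_mk, lowCoeff_apply, coeff_mul_monomial, mul_one]
  rfl

/-- Splitting off the lowest binary digits of the coordinates. -/
def digitEquiv (σ : Type) (q : ℕ) : (σ → Fin q) × (σ → Fin 2) ≃ (σ → Fin (q * 2)) :=
  (Equiv.arrowProdEquivProdArrow σ (fun _ => Fin q) (fun _ => Fin 2)).symm.trans
    (Equiv.arrowCongr (Equiv.refl σ) finProdFinEquiv)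

theorem expo_digitEquiv {q : ℕ} (x : (σ → Fin q) × (σ → Fin 2)) (j : σ) :
    expo (digitEquiv σ q x) j = x.2 j + 2 * x.1 j := rfl

/-- f² has only even exponents, so its matrix does not mix parity classes; on each class it is the
Frobenius twist of the matrix of f. -/
theorem mulMatrix_sq [CharP F 2] (q : ℕ) (f : MvPowerSeries σ F) [DecidableEq (σ → Fin 2)] :
    (mulMatrix (q * 2) (f ^ 2)).submatrix (digitEquiv σ q) (digitEquiv σ q) =
      Matrix.kroneckerMap (· * ·) ((mulMatrix q f).map (frobenius F 2)) 1 := by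
  ext x y
  simp only [Matrix.submatrix_apply, mulMatrix, Matrix.of_apply, Matrix.kroneckerMap_apply,
    Matrix.map_apply, Matrix.one_apply]
  by_cases hxy : x.2 = y.2
  · have h1 : expo (digitEquiv σ q y) ≤ expo (digitEquiv σ q x) ↔ expo y.1 ≤ expo x.1 := by
      refine forall_congr' fun j => ?_
      rw [expo_digitEquiv, expo_digitEquiv, hxy, expo_apply, expo_apply]
      omega
    have h2 : expo (digitEquiv σ q x) - expo (digitEquiv σ q y) = 2 • (expo x.1 - expo y.1) := by
      refine Finsupp.ext fun j => ?_
      rw [Finsupp.tsub_apply, Finsupp.smul_apply, Finsupp.tsub_apply, expo_digitEquiv,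
        expo_digitEquiv, hxy, expo_apply, expo_apply, smul_eq_mul]
      omega
    rw [h2, coeff_two_smul_sq, if_pos hxy, mul_one]
    simp only [h1]
    split_ifs <;> simp
  · rw [if_neg hxy, mul_zero]
    split_ifs with hle
    · obtain ⟨j, hj⟩ := Function.ne_iff.1 hxy
      refine coeff_sq_of_odd f (j := j) ?_
      have h3 := hle j
      rw [expo_digitEquiv, expo_digitEquiv] at h3
      rw [Finsupp.tsub_apply, expo_digitEquiv, expo_digitEquiv]
      have h4 : (x.2 j : ℕ) ≠ y.2 j := fun h => hj (Fin.ext h)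
      have h5 := (x.2 j).2
      have h6 := (y.2 j).2
      omega
    · rfl

theorem frobColength_mul_two [CharP F 2] (f : MvPowerSeries σ F) (q i : ℕ) :
    frobColength f (q * 2) (i * 2) = frobColength f q i * 2 ^ Fintype.card σ := by
  classical
  have h1 := frobColength_add_finrank_range f (q * 2) (i * 2)
  have h2 := frobColength_add_finrank_range f q i
  rw [← rank_mulMatrix, pow_mul, ← Matrix.rank_submatrix _ (digitEquiv σ q) (digitEquiv σ q),
    mulMatrix_sq, Matrix.rank_map_kronecker_one, Fintype.card_fun, Fintype.card_fin] at h1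
  rw [← rank_mulMatrix] at h2
  rw [mul_pow, ← h2, add_mul] at h1
  omega

theorem frobColength_mul_two_pow [CharP F 2] (f : MvPowerSeries σ F) (q i m : ℕ) :
    frobColength f (q * 2 ^ m) (i * 2 ^ m) =
      frobColength f q i * (2 ^ m) ^ Fintype.card σ := by
  induction m with
  | zero => simp
  | succ m ih =>
    rw [pow_succ, ← mul_assoc, ← mul_assoc, frobColength_mul_two, ih, mul_pow, mul_assoc]

/-- This is the well-definedness of φ_f: the formula holds for fractions not in lowest terms, by the
scaling of colengths. -/
theorem phi_node [CharP F 2] (f : MvPowerSeries σ F) (n i : ℕ) (hi : i ≤ 2 ^ n) :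
    phi f (DyadicI.node n i hi) =
      (frobColength f (2 ^ n) i : ℚ) / ((2 ^ n : ℕ) : ℚ) ^ Fintype.card σ := by
  set t := DyadicI.node n i hi with ht
  have htv : t.1 = (i : ℚ) / 2 ^ n := rfl
  have hd : t.1.den ∣ 2 ^ n := by
    have := Rat.den_dvd i (2 ^ n)
    rw [Rat.divInt_eq_div] at this
    push_cast at this
    rw [← htv] at this
    exact_mod_cast this
  obtain ⟨m, hmn, hm⟩ := (Nat.dvd_prime_pow Nat.prime_two).1 hd
  have hq : 2 ^ n = t.1.den * 2 ^ (n - m) := by rw [hm, ← pow_add, Nat.add_sub_cancel' hmn]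
  have hnum : (t.1.num.toNat : ℤ) = t.1.num := Int.toNat_of_nonneg (Rat.num_nonneg.2 t.2.1)
  have hi' : i = t.1.num.toNat * 2 ^ (n - m) := by
    have h1 : (i : ℚ) = t.1 * 2 ^ n := by rw [htv]; field_simp
    have h2 : (t.1.num : ℚ) = t.1 * t.1.den := (Rat.mul_den_eq_num t.1).symm
    have h3 : ((2 ^ n : ℕ) : ℚ) = t.1.den * 2 ^ (n - m) := by rw [hq]; push_cast; rfl
    have h4 : (i : ℚ) = (t.1.num.toNat : ℚ) * 2 ^ (n - m) := by
      have h5 : (t.1.num.toNat : ℚ) = t.1.num := by exact_mod_cast congrArg (Int.cast (R := ℚ)) hnum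
      push_cast at h3
      rw [h5, h2, h1, h3]
      ring
    exact_mod_cast h4
  have hc : frobColength f (2 ^ n) i = frobColength f t.1.den t.1.num.toNat *
      (2 ^ (n - m)) ^ Fintype.card σ := by
    conv_lhs => rw [hq, hi', frobColength_mul_two_pow]
  rw [phi, hc, hq]
  push_cast
  rw [mul_pow, mul_div_mul_right _ _ (by positivity)]

end MvPowerSeries

/-! ### The module F[[u]]/(u^q) with T = f, and its tensor products -/

namespace MvPowerSeries

variable {σ τ : Type} {F : Type u} [Field F]

/-- f lies in (u), and the n-th iterate of Frobenius is a ring homomorphism taking u_j to u_j^{2^n}.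
-/
theorem pow_two_pow_mem_powIdeal [CharP F 2] [Fintype σ] {f : MvPowerSeries σ F}
    (hf : f ∈ IsLocalRing.maximalIdeal (MvPowerSeries σ F)) (n : ℕ) :
    f ^ 2 ^ n ∈ powIdeal σ F (2 ^ n) := by
  have : CharP (MvPowerSeries σ F) 2 :=
    charP_of_injective_algebraMap (algebraMap F (MvPowerSeries σ F)).injective 2
  have h0 : constantCoeff f = 0 := by
    rwa [IsLocalRing.mem_maximalIdeal, mem_nonunits_iff, isUnit_iff_constantCoeff,
      isUnit_iff_ne_zero, not_not] at hf
  have h1 : f ∈ powIdeal σ F 1 := mem_powIdeal_iff.2 fun a ha => by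
    obtain rfl : a = 0 := Finsupp.ext fun j => Nat.lt_one_iff.1 (ha j)
    exact h0
  have h2 : powIdeal σ F 1 ≤ (powIdeal σ F (2 ^ n)).comap
      (iterateFrobenius (MvPowerSeries σ F) 2 n) := by
    refine Ideal.span_le.2 ?_
    rintro _ ⟨j, rfl⟩
    change iterateFrobenius (MvPowerSeries σ F) 2 n (X j ^ 1) ∈ powIdeal σ F (2 ^ n)
    rw [iterateFrobenius_def, pow_one]
    exact Ideal.subset_span ⟨j, rfl⟩
  exact h2 h1

theorem truncMul_pow (q k : ℕ) (f : MvPowerSeries σ F) : truncMul q f ^ k = truncMul q (f ^ k) := by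
  rw [truncMul, truncMul, LinearMap.pow_mulLeft, map_pow]

theorem truncMul_pow_two_pow [CharP F 2] [Fintype σ] {f : MvPowerSeries σ F}
    (hf : f ∈ IsLocalRing.maximalIdeal (MvPowerSeries σ F)) (n : ℕ) :
    truncMul (2 ^ n) f ^ 2 ^ n = 0 := by
  rw [truncMul_pow, truncMul, Ideal.Quotient.eq_zero_iff_mem.2 (pow_two_pow_mem_powIdeal hf n),
    LinearMap.mulLeft_zero_eq_zero]

/-- The `F[T]`-module `F[[u]] / (u ^ (2 ^ n))`, on which `T` acts as `f`. -/
def truncMod [CharP F 2] [Fintype σ] (n : ℕ) {f : MvPowerSeries σ F}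
    (hf : f ∈ IsLocalRing.maximalIdeal (MvPowerSeries σ F)) : NilMod F where
  carrier := Trunc σ F (2 ^ n)
  T := truncMul (2 ^ n) f
  nilpotent := ⟨2 ^ n, truncMul_pow_two_pow hf n⟩

theorem jump_truncMod [CharP F 2] [Fintype σ] (n : ℕ) {f : MvPowerSeries σ F}
    (hf : f ∈ IsLocalRing.maximalIdeal (MvPowerSeries σ F)) (i : ℕ) :
    (truncMod n hf).jump i = (frobColength f (2 ^ n) (i + 1) : ℤ) - frobColength f (2 ^ n) i := by
  have hr : ∀ k, (truncMod n hf).rk k =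
      Module.finrank F (LinearMap.range (truncMul (2 ^ n) (f ^ k))) := fun k => by
    rw [← truncMul_pow]
    rfl
  have h1 := frobColength_add_finrank_range f (2 ^ n) i
  have h2 := frobColength_add_finrank_range f (2 ^ n) (i + 1)
  rw [← hr] at h1 h2
  rw [NilMod.jump]
  omega

theorem scriptL_phi [CharP F 2] [Fintype σ] (n : ℕ) {f : MvPowerSeries σ F}
    (hf : f ∈ IsLocalRing.maximalIdeal (MvPowerSeries σ F)) :
    scriptL F n (phi f) =
      Gamma.cls (truncMod n hf) ⊗ₜ[ℤ] (((2 ^ n : ℕ) : ℚ) ^ Fintype.card σ)⁻¹ := by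
  have h : (truncMod n hf).T ^ 2 ^ n = 0 := truncMul_pow_two_pow hf n
  rw [scriptL_eq, Gamma.cls_eq_sum_jump h, TensorProduct.sum_tmul, Finset.sum_range]
  refine Finset.sum_congr rfl fun i _ => ?_
  rw [TensorProduct.smul_tmul, jump_truncMod, DyadicFun.diff, phi_node, phi_node]
  congr 1
  rw [zsmul_eq_mul]
  push_cast
  ring

theorem phi_zero [CharP F 2] [Fintype σ] (f : MvPowerSeries σ F) : phi f DyadicI.zero = 0 := by
  have h0 : DyadicI.zero = DyadicI.node 0 0 (Nat.zero_le _) :=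
    DyadicI.ext (by simp [DyadicI.node, DyadicI.zero])
  have h1 : frobColength f (2 ^ 0) 0 = 0 := by
    have h : Ideal.span (Set.range (fun j : σ => (X j : MvPowerSeries σ F) ^ 2 ^ 0) ∪ {f ^ 0}) = ⊤ :=
      Ideal.eq_top_of_unit_mem _ 1 1 (Ideal.subset_span (Or.inr (pow_zero f).symm)) (one_mul 1)
    rw [frobColength, h]
    exact Module.finrank_zero_of_subsingleton
  rw [h0, phi_node, h1, Nat.cast_zero, zero_div]

/-- Renaming the variables of a truncated power series. -/
def truncRename (q : ℕ) (e : σ → τ) [Filter.TendstoCofinite e] :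
    Trunc σ F q →ₐ[F] Trunc τ F q :=
  Ideal.quotientMapₐ (powIdeal τ F q) (rename e) (Ideal.span_le.2 (by
    rintro _ ⟨j, rfl⟩
    refine Ideal.mem_comap.2 ?_
    rw [map_pow, rename_X]
    exact Ideal.subset_span ⟨e j, rfl⟩))

theorem truncRename_mk (q : ℕ) (e : σ → τ) [Filter.TendstoCofinite e] (f : MvPowerSeries σ F) :
    truncRename q e (Ideal.Quotient.mk _ f) = Ideal.Quotient.mk _ (rename e f) := rfl

/-- Modulo (u^q) every power series is a polynomial. -/
theorem subalgebra_trunc_eq_top [Fintype σ] {q : ℕ} {S : Subalgebra F (Trunc σ F q)}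
    (h : ∀ j, Ideal.Quotient.mk (powIdeal σ F q) (X j) ∈ S) : S = ⊤ := by
  refine eq_top_iff.2 fun x _ => ?_
  obtain ⟨f, rfl⟩ := Ideal.Quotient.mk_surjective x
  have hpoly : ∀ p : MvPolynomial σ F,
      Ideal.Quotient.mk (powIdeal σ F q) (p : MvPowerSeries σ F) ∈ S := fun p => by
    induction p using MvPolynomial.induction_on with
    | C a => rw [MvPolynomial.coe_C]; exact S.algebraMap_mem a
    | add p r hp hr => rw [MvPolynomial.coe_add, map_add]; exact add_mem hp hr
    | mul_X p j hp => rw [MvPolynomial.coe_mul, map_mul, MvPolynomial.coe_X]; exact mul_mem hp (h j)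
  classical
  let p : MvPolynomial σ F := ∑ a : σ → Fin q, MvPolynomial.monomial (expo a) (coeff (expo a) f)
  have hp : Ideal.Quotient.mk (powIdeal σ F q) f =
      Ideal.Quotient.mk (powIdeal σ F q) (p : MvPowerSeries σ F) := by
    rw [Ideal.Quotient.eq, mem_powIdeal_iff]
    intro a ha
    obtain ⟨b, rfl⟩ := exists_expo_eq ha
    rw [map_sub, MvPolynomial.coeff_coe, MvPolynomial.coeff_sum]
    simp only [MvPolynomial.coeff_monomial, expo_injective.eq_iff]
    simp
  rw [hp]
  exact hpoly p

/-- The multiplication `F[[u]] / (u ^ q) ⊗ F[[v]] / (v ^ q) → F[[u, v]] / (u ^ q, v ^ q)`. -/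
def truncProd (σ τ : Type) (F : Type u) [Field F] [Fintype σ] [Fintype τ] (q : ℕ) :
    Trunc σ F q ⊗[F] Trunc τ F q →ₐ[F] Trunc (σ ⊕ τ) F q :=
  Algebra.TensorProduct.productMap (truncRename q Sum.inl) (truncRename q Sum.inr)

variable [Fintype σ] [Fintype τ]

theorem truncProd_tmul (q : ℕ) (x : Trunc σ F q) (y : Trunc τ F q) :
    truncProd σ τ F q (x ⊗ₜ y) = truncRename q Sum.inl x * truncRename q Sum.inr y := rfl

theorem truncProd_surjective (q : ℕ) : Function.Surjective (truncProd σ τ F q) := by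
  rw [← AlgHom.range_eq_top]
  refine subalgebra_trunc_eq_top ?_
  rintro (j | j)
  · refine ⟨Ideal.Quotient.mk _ (X j) ⊗ₜ 1, ?_⟩
    refine (truncProd_tmul _ _ _).trans ?_
    rw [truncRename_mk, rename_X, map_one, mul_one]
  · refine ⟨1 ⊗ₜ Ideal.Quotient.mk _ (X j), ?_⟩
    refine (truncProd_tmul _ _ _).trans ?_
    rw [truncRename_mk, rename_X, map_one, one_mul]

/-- The image contains all the variables, and the two dimensions agree. -/
theorem truncProd_bijective (q : ℕ) : Function.Bijective (truncProd σ τ F q) := by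
  have h : Module.finrank F (Trunc σ F q ⊗[F] Trunc τ F q) =
      Module.finrank F (Trunc (σ ⊕ τ) F q) := by
    rw [Module.finrank_tensorProduct, finrank_trunc, finrank_trunc, finrank_trunc,
      Fintype.card_sum, pow_add]
  exact ⟨(LinearMap.injective_iff_surjective_of_finrank_eq_finrank
    (f := (truncProd σ τ F q).toLinearMap) h).2 (truncProd_surjective q), truncProd_surjective q⟩

variable {f : MvPowerSeries σ F} {g : MvPowerSeries τ F}

theorem rename_add_rename_mem_maximalIdeal
    (hf : f ∈ IsLocalRing.maximalIdeal (MvPowerSeries σ F))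
    (hg : g ∈ IsLocalRing.maximalIdeal (MvPowerSeries τ F)) :
    rename Sum.inl f + rename Sum.inr g ∈
      IsLocalRing.maximalIdeal (MvPowerSeries (σ ⊕ τ) F) := by
  rw [IsLocalRing.mem_maximalIdeal, mem_nonunits_iff, isUnit_iff_constantCoeff,
      isUnit_iff_ne_zero, not_not] at hf hg ⊢
  rw [map_add, constantCoeff_rename, constantCoeff_rename, hf, hg, add_zero]

theorem truncProd_truncMul (q : ℕ) (x : Trunc σ F q) (y : Trunc τ F q) :
    truncProd σ τ F q (truncMul q f x ⊗ₜ y + x ⊗ₜ truncMul q g y) =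
      truncMul q (rename Sum.inl f + rename Sum.inr g) (truncProd σ τ F q (x ⊗ₜ y)) := by
  rw [map_add, truncProd_tmul, truncProd_tmul, truncProd_tmul]
  simp only [truncMul, LinearMap.mulLeft_apply, map_mul, map_add, truncRename_mk]
  ring

variable [CharP F 2]

theorem truncMod_tensor_iso (n : ℕ) (hf : f ∈ IsLocalRing.maximalIdeal (MvPowerSeries σ F))
    (hg : g ∈ IsLocalRing.maximalIdeal (MvPowerSeries τ F)) :
    ((truncMod n hf).tensor (truncMod n hg)).Iso
      (truncMod n (rename_add_rename_mem_maximalIdeal hf hg)) := by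
  refine ⟨LinearEquiv.ofBijective (truncProd σ τ F (2 ^ n)).toLinearMap (truncProd_bijective _),
    NilMod.tensor_hom_ext fun x y => ?_⟩
  exact truncProd_truncMul (2 ^ n) x y

theorem scriptL_phi_rename_add_rename (n : ℕ)
    (hf : f ∈ IsLocalRing.maximalIdeal (MvPowerSeries σ F))
    (hg : g ∈ IsLocalRing.maximalIdeal (MvPowerSeries τ F)) :
    scriptL F n (phi (rename Sum.inl f + rename Sum.inr g)) =
      scriptL F n (phi f) * scriptL F n (phi g) := by
  rw [scriptL_phi n hf, scriptL_phi n hg,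
    scriptL_phi n (rename_add_rename_mem_maximalIdeal hf hg),
    Algebra.TensorProduct.tmul_mul_tmul, ← Gamma.cls_tensor,
    Gamma.cls_eq (truncMod_tensor_iso n hf hg), Fintype.card_sum, pow_add, mul_inv]

end MvPowerSeries

end

/-- Here `h = f(u) + g(v)` in `F[[u, v]]`, the variables `u` and `v` being indexed by the two
summands of `Fin r ⊕ Fin s`. -/
theorem theorem1p9 {F : Type*} [Field F] [CharP F 2] {r s : ℕ}
    (f : MvPowerSeries (Fin r) F) (g : MvPowerSeries (Fin s) F)
    (hf0 : f ≠ 0) (hf : f ∈ IsLocalRing.maximalIdeal (MvPowerSeries (Fin r) F))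
    (hg0 : g ≠ 0) (hg : g ∈ IsLocalRing.maximalIdeal (MvPowerSeries (Fin s) F))
    (h : MvPowerSeries (Fin r ⊕ Fin s) F)
    (hh : h = MvPowerSeries.rename Sum.inl f + MvPowerSeries.rename Sum.inr g) :
    (∀ n : ℕ, scriptL F n (phi h) = scriptL F n (phi f) * scriptL F n (phi g)) ∧
      phi h = DyadicFun.sharp (phi f) (phi g) := by
  subst hh
  have hL := fun n => MvPowerSeries.scriptL_phi_rename_add_rename n hf hg
  refine ⟨hL, eq_of_scriptL_eq F ?_ fun n => ?_⟩
  · rw [MvPowerSeries.phi_zero, DyadicFun.sharp_zero]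
  · rw [hL, scriptL_sharp]
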